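/- Let $\mathfrak g$ be a finite-dimensional complex semisimple Lie algebra with a Cartan subalgebra $\mathfrak h$ and a set of simple roots, let $P^+$ be the set of dominant integral weights, and let $V(\lambda)$ be the simple finite-dimensional $\mathfrak g$-module with highest weight $\lambda\in P^+$. Let $V$ be a finite-dimensional $\mathfrak g$-module, and let $\mathfrak a=\mathfrak g\ltimes V$, where $V$ is an abelian ideal, graded by $\mathfrak a_0=\mathfrak g$, $\mathfrak a_1=V$ and $\mathfrak a_k=0$ for $k>1$. Let $\widehat{\mathcal G}$ be the category of $\mathbb Z$-graded $\mathfrak a$-modules $M=\bigoplus_{r\in\mathbb Z}M[r]$ (so $\mathfrak a_kM[r]\subseteq M[r+k]$) with all $M[r]$ finite-dimensional; its morphisms are the $\mathfrak a$-module maps which preserve the grading. Put $\Lambda=P^+\times\mathbb Z$. For $(\lambda,r)\in\Lambda$ let $V(\lambda,r)\in\widehat{\mathcal G}$ be the module $V(\lambda)$ placed in degree $r$, on which $V$ acts by zero, and put $[M:V(\lambda,r)]=\dim\operatorname{Hom}_{\mathfrak g}(V(\lambda),M[r])$. Say that $(\mu,s)$ covers $(\lambda,r)$ if $s>r$ and $\mu-\lambda$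 is a weight of $\mathfrak a_{s-r}$, and let $\preccurlyeq$ be the reflexive and transitive closure of this relation on $\Lambda$. A subset $\Gamma\subseteq\Lambda$ is interval-closed if $x\preccurlyeq t\preccurlyeq y$ with $x,y\in\Gamma$ and $t\in\Lambda$ implies $t\in\Gamma$. Let $\mathcal G[\Gamma]$ be the full subcategory of $\widehat{\mathcal G}$ whose objects are the finite-dimensional $M$ such that $[M:V(\lambda,r)]>0$ implies $(\lambda,r)\in\Gamma$; it is an abelian subcategory, and the inclusion is exact. **Proposition.** Let $\Gamma\subseteq\Lambda$ be finite and interval-closed. Then for all $(\mu,r),(\nu,s)\in\Gamma$ and all integers $j\ge 0$ there is a $\mathbb C$-linear isomorphism $$\operatorname{Ext}^j_{\mathcal G[\Gamma]}(V(\mu,r),V(\nu,s))\;\cong\;\operatorname{Ext}^j_{\widehat{\mathcal G}}(V(\mu,r),V(\nu,s)),$$ namely the canonical map induced by the inclusion functor $\mathcal G[\Gamma]\to\widehat{\mathcal G}$. -/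

import Mathlib

open CategoryTheory CategoryTheory.Limits

set_option linter.unusedVariables false

universe u v w

/-- A `ℤ`-graded module `M = ⨁ M[r]` over a Lie algebra `a` with graded pieces `𝒶 n`
(`n : ℕ`), all of whose graded components `M[r]` are finite-dimensional. -/
structure GrLieMod {a : Type u} [LieRing a] [LieAlgebra ℂ a] (𝒶 : ℕ → Submodule ℂ a) where
  carrier : Type w
  [addCommGroup : AddCommGroup carrier]
  [module : Module ℂ carrier]
  [lieRingModule : LieRingModule a carrier]
  [lieModule : LieModule ℂ a carrier]
  grade : ℤ → Submodule ℂ carrier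
  isInternal : DirectSum.IsInternal grade
  lie_mem : ∀ (n : ℕ) (r : ℤ) (x : a) (m : carrier), x ∈ 𝒶 n → m ∈ grade r →
    ⁅x, m⁆ ∈ grade (r + n)
  finite : ∀ r, FiniteDimensional ℂ (grade r)

namespace GrLieMod

attribute [instance] addCommGroup module lieRingModule lieModule finite

variable {a : Type u} [LieRing a] [LieAlgebra ℂ a] {𝒶 : ℕ → Submodule ℂ a}

instance : CoeSort (GrLieMod.{u, w} 𝒶) (Type w) := ⟨carrier⟩

/-- Morphisms of graded modules: `a`-module maps `f` with `f(M[r]) ⊆ N[r]` for all `r`. -/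
@[ext]
structure Hom (M N : GrLieMod.{u, w} 𝒶) where
  toLie : M →ₗ⁅ℂ,a⁆ N
  map_grade : ∀ (r : ℤ) (m : M), m ∈ M.grade r → toLie m ∈ N.grade r

instance : Category (GrLieMod.{u, w} 𝒶) where
  Hom := Hom
  id M := ⟨LieModuleHom.id, fun _ _ h ↦ h⟩
  comp f g := ⟨g.toLie.comp f.toLie, fun r m h ↦ g.map_grade r _ (f.map_grade r m h)⟩

variable {M N K : GrLieMod.{u, w} 𝒶}

@[ext]
theorem hom_ext {f g : M ⟶ N} (h : ∀ m, f.toLie m = g.toLie m) : f = g :=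
  Hom.ext (LieModuleHom.ext h)

@[simp] theorem id_toLie (m : M) : Hom.toLie (𝟙 M) m = m := rfl

@[simp] theorem comp_toLie (f : M ⟶ N) (g : N ⟶ K) (m : M) :
    Hom.toLie (f ≫ g) m = g.toLie (f.toLie m) := rfl

instance : AddCommGroup (M ⟶ N) where
  add f g := ⟨f.toLie + g.toLie, fun r m h ↦ add_mem (f.map_grade r m h) (g.map_grade r m h)⟩
  zero := ⟨0, fun _ _ _ ↦ zero_mem _⟩
  neg f := ⟨-f.toLie, fun r m h ↦ neg_mem (f.map_grade r m h)⟩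
  sub f g := ⟨f.toLie - g.toLie, fun r m h ↦ sub_mem (f.map_grade r m h) (g.map_grade r m h)⟩
  nsmul n f := ⟨n • f.toLie, fun r m h ↦ nsmul_mem (f.map_grade r m h) n⟩
  zsmul n f := ⟨n • f.toLie, fun r m h ↦ zsmul_mem (f.map_grade r m h) n⟩
  add_assoc f g h := Hom.ext (add_assoc _ _ _)
  zero_add f := Hom.ext (zero_add _)
  add_zero f := Hom.ext (add_zero _)
  neg_add_cancel f := Hom.ext (neg_add_cancel _)
  add_comm f g := Hom.ext (add_comm _ _)
  sub_eq_add_neg f g := Hom.ext (sub_eq_add_neg _ _)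
  nsmul_zero f := Hom.ext (zero_nsmul _)
  nsmul_succ n f := Hom.ext (succ_nsmul _ _)
  zsmul_zero' f := Hom.ext (zero_zsmul _)
  zsmul_succ' n f := Hom.ext (SubNegMonoid.zsmul_succ' _ _)
  zsmul_neg' n f := Hom.ext (SubNegMonoid.zsmul_neg' _ _)

@[simp] theorem add_toLie (f g : M ⟶ N) (m : M) :
    Hom.toLie (f + g) m = f.toLie m + g.toLie m := rfl

@[simp] theorem zero_toLie (m : M) : Hom.toLie (0 : M ⟶ N) m = 0 := rfl

instance : Module ℂ (M ⟶ N) where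
  smul c f := ⟨c • f.toLie, fun r m h ↦ Submodule.smul_mem _ c (f.map_grade r m h)⟩
  one_smul f := Hom.ext (one_smul _ _)
  mul_smul c d f := Hom.ext (mul_smul _ _ _)
  smul_zero c := Hom.ext (smul_zero _)
  smul_add c f g := Hom.ext (smul_add _ _ _)
  add_smul c d f := Hom.ext (add_smul _ _ _)
  zero_smul f := Hom.ext (zero_smul _ _)

@[simp] theorem smul_toLie (c : ℂ) (f : M ⟶ N) (m : M) :
    Hom.toLie (c • f) m = c • f.toLie m := rfl

instance : Preadditive (GrLieMod.{u, w} 𝒶) where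
  add_comp _ _ _ f f' g := by ext; simp
  comp_add _ _ _ f g g' := by ext; simp

instance : Linear ℂ (GrLieMod.{u, w} 𝒶) where
  smul_comp _ _ _ c f g := by ext; simp
  comp_smul _ _ _ f c g := by ext; simp

theorem isInternal_of_proj {E : Type*} [AddCommGroup E] [Module ℂ E] (p : ℤ → Submodule ℂ E)
    (htop : ⨆ r, p r = ⊤) (q : ℤ → E →ₗ[ℂ] E) (h1 : ∀ r, ∀ m ∈ p r, q r m = m)
    (h2 : ∀ r s, r ≠ s → ∀ m ∈ p s, q r m = 0) : DirectSum.IsInternal p := by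
  rw [DirectSum.isInternal_submodule_iff_iSupIndep_and_iSup_eq_top]
  refine ⟨fun r ↦ ?_, htop⟩
  rw [Submodule.disjoint_def]
  intro m hm hm'
  have : (⨆ (s) (_ : s ≠ r), p s) ≤ LinearMap.ker (q r) :=
    iSup₂_le fun s hs m hm ↦ h2 r s hs.symm m hm
  rw [← h1 r m hm]
  exact this hm'

/-- The projection of a graded module onto its component of degree `r`. -/
noncomputable def proj (M : GrLieMod.{u, w} 𝒶) (r : ℤ) : M →ₗ[ℂ] M :=
  (M.grade r).subtype ∘ₗ DirectSum.component ℂ ℤ (fun r ↦ M.grade r) r ∘ₗ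
    (LinearEquiv.ofBijective (DirectSum.coeLinearMap M.grade) M.isInternal).symm.toLinearMap

theorem proj_mem (r : ℤ) (m : M) : M.proj r m ∈ M.grade r := by simp [proj]

theorem proj_of_mem (r s : ℤ) (m : M) (hm : m ∈ M.grade s) :
    M.proj r m = if r = s then m else 0 := by
  have : (LinearEquiv.ofBijective (DirectSum.coeLinearMap M.grade) M.isInternal).symm m =
      DirectSum.lof ℂ ℤ (fun r ↦ M.grade r) s ⟨m, hm⟩ := by
    rw [LinearEquiv.symm_apply_eq]
    exact (DirectSum.coeLinearMap_lof M.grade s ⟨m, hm⟩).symm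
  simp only [proj, LinearMap.comp_apply, LinearEquiv.coe_coe, this]
  split_ifs with h
  · subst h; simp [DirectSum.component.lof_self]
  · simp [DirectSum.component.of, Ne.symm h]

theorem exists_eq_sum_proj (m : M) : ∃ s : Finset ℤ, m = ∑ r ∈ s, M.proj r m := by
  classical
  set e := LinearEquiv.ofBijective (DirectSum.coeLinearMap M.grade) M.isInternal
  refine ⟨(e.symm m).support, ?_⟩
  conv_lhs => rw [← e.apply_symm_apply m]
  change DirectSum.coeLinearMap M.grade (e.symm m) = _
  rw [DirectSum.coeLinearMap_eq_dfinsuppSum]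
  rfl

theorem map_proj (f : M ⟶ N) (r : ℤ) (m : M) : f.toLie (M.proj r m) = N.proj r (f.toLie m) := by
  have : (f.toLie : M →ₗ[ℂ] N) ∘ₗ M.proj r = N.proj r ∘ₗ (f.toLie : M →ₗ[ℂ] N) := by
    have htop := M.isInternal.submodule_iSup_eq_top
    ext m
    have hm : m ∈ ⨆ r, M.grade r := by rw [htop]; trivial
    induction hm using Submodule.iSup_induction' with
    | mem s m hm =>
      have := f.map_grade s m hm
      simp only [LinearMap.comp_apply, LieModuleHom.coe_toLinearMap, proj_of_mem r s m hm,
        proj_of_mem r s _ this]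
      split_ifs <;> simp
    | zero => simp
    | add x y _ _ hx hy => rw [map_add, map_add, hx, hy]
  exact LinearMap.congr_fun this m

/-- The graded submodule of `M` on an `a`-submodule `S` which contains the homogeneous components
of its elements. -/
@[simps carrier grade]
noncomputable def sub (M : GrLieMod.{u, w} 𝒶) (S : LieSubmodule ℂ a M)
    (hS : ∀ r, ∀ m ∈ S, M.proj r m ∈ S) : GrLieMod.{u, w} 𝒶 where
  carrier := S
  grade r := (M.grade r).comap S.toSubmodule.subtype
  isInternal := by
    refine isInternal_of_proj _ ?_ (fun r ↦ (M.proj r).restrict (hS r)) ?_ ?_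
    · rw [eq_top_iff]
      rintro ⟨m, hm⟩ -
      obtain ⟨s, hs⟩ := exists_eq_sum_proj m
      have : (⟨m, hm⟩ : S) = ∑ r ∈ s, ⟨M.proj r m, hS r m hm⟩ := by
        ext
        simpa using hs
      rw [this]
      exact Submodule.sum_mem _ fun r _ ↦ Submodule.mem_iSup_of_mem r (proj_mem r m)
    · intro r m hm
      ext
      exact (proj_of_mem r r _ hm).trans (if_pos rfl)
    · intro r s h m hm
      ext
      exact (proj_of_mem r s _ hm).trans (if_neg h)
  lie_mem n r x m hx hm := M.lie_mem n r x m hx hm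
  finite r := by
    let f : (M.grade r).comap S.toSubmodule.subtype →ₗ[ℂ] M.grade r :=
      S.toSubmodule.subtype.restrict fun m hm ↦ hm
    exact FiniteDimensional.of_injective f fun x y h ↦ by
      have := congrArg Subtype.val h
      exact Subtype.ext (Subtype.ext this)

/-- The quotient of `M` by a graded submodule. -/
@[simps carrier grade]
noncomputable def quot (M : GrLieMod.{u, w} 𝒶) (S : LieSubmodule ℂ a M)
    (hS : ∀ r, ∀ m ∈ S, M.proj r m ∈ S) : GrLieMod.{u, w} 𝒶 where
  carrier := M ⧸ S
  grade r := (M.grade r).map S.toSubmodule.mkQ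
  isInternal := by
    refine isInternal_of_proj _ ?_
      (fun r ↦ S.toSubmodule.mapQ S.toSubmodule (M.proj r) (hS r)) ?_ ?_
    · rw [← Submodule.map_iSup, M.isInternal.submodule_iSup_eq_top, Submodule.map_top,
        Submodule.range_mkQ]
    · rintro r _ ⟨m, hm, rfl⟩
      exact congrArg S.toSubmodule.mkQ ((proj_of_mem r r _ hm).trans (if_pos rfl))
    · rintro r s h _ ⟨m, hm, rfl⟩
      exact (congrArg S.toSubmodule.mkQ ((proj_of_mem r s _ hm).trans (if_neg h))).trans (map_zero _)
  lie_mem n r x m hx hm := by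
    obtain ⟨m, hm, rfl⟩ := hm
    exact ⟨⁅x, m⁆, M.lie_mem n r x m hx hm, rfl⟩
  finite r := inferInstance

/-- The inclusion of a graded submodule. -/
noncomputable def subι (M : GrLieMod.{u, w} 𝒶) (S : LieSubmodule ℂ a M)
    (hS : ∀ r, ∀ m ∈ S, M.proj r m ∈ S) : M.sub S hS ⟶ M :=
  (⟨S.incl, fun r m h ↦ h⟩ : Hom (M.sub S hS) M)

/-- The projection to the quotient by a graded submodule. -/
noncomputable def quotπ (M : GrLieMod.{u, w} 𝒶) (S : LieSubmodule ℂ a M)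
    (hS : ∀ r, ∀ m ∈ S, M.proj r m ∈ S) : M ⟶ M.quot S hS :=
  (⟨LieSubmodule.Quotient.mk' S, fun r m h ↦ ⟨m, h, rfl⟩⟩ : Hom M (M.quot S hS))

theorem ker_proj (f : M ⟶ N) (r : ℤ) (m : M) (hm : m ∈ f.toLie.ker) :
    M.proj r m ∈ f.toLie.ker := by
  rw [LieModuleHom.mem_ker] at hm ⊢
  rw [map_proj, hm, map_zero]

theorem range_proj (f : M ⟶ N) (r : ℤ) (m : N) (hm : m ∈ f.toLie.range) :
    N.proj r m ∈ f.toLie.range := by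
  rw [LieModuleHom.mem_range] at hm ⊢
  obtain ⟨m, rfl⟩ := hm
  exact ⟨M.proj r m, map_proj f r m⟩

/-- Factorization of a morphism through an injective one. -/
noncomputable def liftInj {S M T : GrLieMod.{u, w} 𝒶} (j : S ⟶ M)
    (hj : Function.Injective j.toLie) (k : T ⟶ M) (hk : ∀ t, ∃ s, j.toLie s = k.toLie t) :
    T ⟶ S :=
  have spec : ∀ t, j.toLie (hk t).choose = k.toLie t := fun t ↦ (hk t).choose_spec
  (⟨{ toFun := fun t ↦ (hk t).choose
      map_add' := fun x y ↦ hj ((spec _).trans (by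
        rw [map_add, map_add, spec, spec]))
      map_smul' := fun c x ↦ hj ((spec _).trans (by
        rw [RingHom.id_apply, map_smul, map_smul, spec]))
      map_lie' := fun {x m} ↦ hj ((spec _).trans (by
        rw [LieModuleHom.map_lie, LieModuleHom.map_lie, spec])) },
    fun r t ht ↦ by
      change (hk t).choose ∈ S.grade r
      have h1 : S.proj r (hk t).choose = (hk t).choose := hj (by
        rw [map_proj, spec]
        exact (proj_of_mem r r _ (k.map_grade r t ht)).trans (if_pos rfl))
      rw [← h1]
      exact proj_mem r _⟩ : Hom T S)

theorem liftInj_spec {S M T : GrLieMod.{u, w} 𝒶} (j : S ⟶ M)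
    (hj : Function.Injective j.toLie) (k : T ⟶ M) (hk : ∀ t, ∃ s, j.toLie s = k.toLie t) :
    liftInj j hj k hk ≫ j = k := by
  ext t
  exact (hk t).choose_spec

/-- Factorization of a morphism through a surjective one. -/
noncomputable def descSurj {M C T : GrLieMod.{u, w} 𝒶} (p : M ⟶ C)
    (hp : Function.Surjective p.toLie) (k : M ⟶ T)
    (hk : ∀ m, p.toLie m = 0 → k.toLie m = 0) : C ⟶ T :=
  have key : ∀ m m', p.toLie m = p.toLie m' → k.toLie m = k.toLie m' := fun m m' h ↦
    sub_eq_zero.mp (by rw [← map_sub]; exact hk _ (by rw [map_sub, h, sub_self]))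
  have spec : ∀ c, p.toLie (hp c).choose = c := fun c ↦ (hp c).choose_spec
  (⟨{ toFun := fun c ↦ k.toLie (hp c).choose
      map_add' := fun x y ↦ by
        rw [← map_add]
        exact key _ _ (by rw [map_add, spec, spec, spec])
      map_smul' := fun c x ↦ by
        rw [RingHom.id_apply, ← map_smul]
        exact key _ _ (by rw [map_smul, spec, spec])
      map_lie' := fun {x m} ↦ by
        rw [← LieModuleHom.map_lie]
        exact key _ _ (by rw [LieModuleHom.map_lie, spec, spec]) },
    fun r c hc ↦ by
      change k.toLie (hp c).choose ∈ T.grade r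
      have h1 : k.toLie (hp c).choose = k.toLie (M.proj r (hp c).choose) := key _ _ (by
        rw [map_proj, spec]
        exact ((proj_of_mem r r _ hc).trans (if_pos rfl)).symm)
      rw [h1]
      exact k.map_grade r _ (proj_mem r _)⟩ : Hom C T)

theorem descSurj_spec {M C T : GrLieMod.{u, w} 𝒶} (p : M ⟶ C)
    (hp : Function.Surjective p.toLie) (k : M ⟶ T)
    (hk : ∀ m, p.toLie m = 0 → k.toLie m = 0) : p ≫ descSurj p hp k hk = k := by
  ext m
  change k.toLie (hp (p.toLie m)).choose = k.toLie m
  refine sub_eq_zero.mp ?_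
  rw [← map_sub]
  exact hk _ (by rw [map_sub, (hp (p.toLie m)).choose_spec, sub_self])

theorem comp_apply_eq_zero {f : M ⟶ N} {g : N ⟶ K} (h : f ≫ g = 0) (m : M) :
    g.toLie (f.toLie m) = 0 :=
  congrArg (fun h ↦ Hom.toLie h m) h

/-- An injective morphism whose range is the kernel of `g` is a kernel of `g`. -/
noncomputable def isLimitOfInjective (f : M ⟶ N) (g : N ⟶ K) (h : f ≫ g = 0)
    (hf : Function.Injective f.toLie) (hex : ∀ n, g.toLie n = 0 → ∃ m, f.toLie m = n) :
    IsLimit (KernelFork.ofι f h) :=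
  KernelFork.IsLimit.ofι f h
    (fun k hk ↦ liftInj f hf k fun t ↦ hex _ (comp_apply_eq_zero hk t))
    (fun k hk ↦ liftInj_spec f hf k _)
    (fun k hk m hm ↦ by
      ext t
      apply hf
      rw [← comp_toLie, ← comp_toLie, hm, liftInj_spec])

/-- A surjective morphism whose kernel is the range of `f` is a cokernel of `f`. -/
noncomputable def isColimitOfSurjective (f : M ⟶ N) (g : N ⟶ K) (h : f ≫ g = 0)
    (hg : Function.Surjective g.toLie) (hex : ∀ n, g.toLie n = 0 → ∃ m, f.toLie m = n) :
    IsColimit (CokernelCofork.ofπ g h) :=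
  CokernelCofork.IsColimit.ofπ g h
    (fun k hk ↦ descSurj g hg k fun n hn ↦ by
      obtain ⟨m, rfl⟩ := hex n hn
      exact comp_apply_eq_zero hk m)
    (fun k hk ↦ descSurj_spec g hg k _)
    (fun k hk m hm ↦ by
      ext c
      obtain ⟨n, rfl⟩ := hg c
      rw [← comp_toLie, ← comp_toLie, hm, descSurj_spec])

/-- The inclusion of the kernel of a morphism. -/
noncomputable def kerι (f : M ⟶ N) : M.sub f.toLie.ker (ker_proj f) ⟶ M :=
  M.subι f.toLie.ker (ker_proj f)

theorem kerι_comp (f : M ⟶ N) : kerι f ≫ f = 0 := by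
  ext m
  exact LieModuleHom.mem_ker.mp m.2

theorem kerι_injective (f : M ⟶ N) : Function.Injective (kerι f).toLie :=
  Subtype.val_injective

theorem exists_kerι (f : M ⟶ N) (m : M) (hm : f.toLie m = 0) : ∃ x, (kerι f).toLie x = m :=
  ⟨⟨m, LieModuleHom.mem_ker.mpr hm⟩, rfl⟩

/-- The projection to the cokernel of a morphism. -/
noncomputable def cokerπ (f : M ⟶ N) : N ⟶ N.quot f.toLie.range (range_proj f) :=
  N.quotπ f.toLie.range (range_proj f)

theorem comp_cokerπ (f : M ⟶ N) : f ≫ cokerπ f = 0 := by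
  ext m
  exact (LieSubmodule.Quotient.mk_eq_zero'  (N := f.toLie.range)).mpr
    ((LieModuleHom.mem_range _ _).mpr ⟨m, rfl⟩)

theorem cokerπ_surjective (f : M ⟶ N) : Function.Surjective (cokerπ f).toLie :=
  LieSubmodule.Quotient.surjective_mk' _

theorem exists_cokerπ (f : M ⟶ N) (n : N) (hn : (cokerπ f).toLie n = 0) :
    ∃ m, f.toLie m = n :=
  (LieModuleHom.mem_range _ _).mp
    ((LieSubmodule.Quotient.mk_eq_zero' (N := f.toLie.range)).mp hn)

instance : HasKernels (GrLieMod.{u, w} 𝒶) where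
  has_limit f := ⟨_, isLimitOfInjective (kerι f) f (kerι_comp f) (kerι_injective f) (exists_kerι f)⟩

instance : HasCokernels (GrLieMod.{u, w} 𝒶) where
  has_colimit f := ⟨_, isColimitOfSurjective f (cokerπ f) (comp_cokerπ f) (cokerπ_surjective f)
    (exists_cokerπ f)⟩

theorem injective_of_mono (f : M ⟶ N) [Mono f] : Function.Injective f.toLie := by
  have h : kerι f = 0 := by rw [← cancel_mono f, kerι_comp, zero_comp]
  rw [injective_iff_map_eq_zero]
  intro m hm
  obtain ⟨x, rfl⟩ := exists_kerι f m hm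
  rw [h]; rfl

theorem surjective_of_epi (f : M ⟶ N) [Epi f] : Function.Surjective f.toLie := by
  have h : cokerπ f = 0 := by rw [← cancel_epi f, comp_cokerπ, comp_zero]
  intro n
  exact exists_cokerπ f n (by rw [h]; rfl)

instance : IsNormalMonoCategory (GrLieMod.{u, w} 𝒶) where
  normalMonoOfMono f _ := ⟨⟨_, cokerπ f, comp_cokerπ f,
    isLimitOfInjective f (cokerπ f) (comp_cokerπ f) (injective_of_mono f) (exists_cokerπ f)⟩⟩

instance : IsNormalEpiCategory (GrLieMod.{u, w} 𝒶) where
  normalEpiOfEpi f _ := ⟨⟨_, kerι f, kerι_comp f,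
    isColimitOfSurjective (kerι f) f (kerι_comp f) (surjective_of_epi f) (exists_kerι f)⟩⟩

/-- The zero module. -/
def zeroMod (𝒶 : ℕ → Submodule ℂ a) : GrLieMod.{u, w} 𝒶 where
  carrier := PUnit
  lieRingModule :=
    { bracket := fun _ _ ↦ 0
      add_lie := fun _ _ _ ↦ rfl
      lie_add := fun _ _ _ ↦ rfl
      leibniz_lie := fun _ _ _ ↦ rfl }
  lieModule :=
    letI : LieRingModule a PUnit :=
      { bracket := fun _ _ ↦ 0
        add_lie := fun _ _ _ ↦ rfl
        lie_add := fun _ _ _ ↦ rfl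
        leibniz_lie := fun _ _ _ ↦ rfl }
    { smul_lie := fun _ _ _ ↦ rfl
      lie_smul := fun _ _ _ ↦ rfl }
  grade _ := ⊤
  isInternal := isInternal_of_proj _ (iSup_const) (fun _ ↦ 0) (fun _ _ _ ↦ rfl)
    (fun _ _ _ _ _ ↦ rfl)
  lie_mem _ _ _ _ _ _ := Submodule.mem_top
  finite _ := inferInstance

instance : HasZeroObject (GrLieMod.{u, w} 𝒶) :=
  ⟨zeroMod 𝒶, (IsZero.iff_id_eq_zero _).mpr rfl⟩

/-- The diagonal action of a Lie algebra on a product of two modules. -/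
instance prodLieRingModule (M N : GrLieMod.{u, w} 𝒶) : LieRingModule a (M × N) where
  bracket x m := (⁅x, m.1⁆, ⁅x, m.2⁆)
  add_lie _ _ _ := Prod.ext (add_lie _ _ _) (add_lie _ _ _)
  lie_add _ _ _ := Prod.ext (lie_add _ _ _) (lie_add _ _ _)
  leibniz_lie _ _ _ := Prod.ext (leibniz_lie _ _ _) (leibniz_lie _ _ _)

instance prodLieModule (M N : GrLieMod.{u, w} 𝒶) : LieModule ℂ a (M × N) where
  smul_lie _ _ _ := Prod.ext (smul_lie _ _ _) (smul_lie _ _ _)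
  lie_smul _ _ _ := Prod.ext (lie_smul _ _ _) (lie_smul _ _ _)

/-- The direct sum of two modules. -/
def prod (M N : GrLieMod.{u, w} 𝒶) : GrLieMod.{u, w} 𝒶 where
  carrier := M × N
  grade r := (M.grade r).prod (N.grade r)
  isInternal := by
    refine isInternal_of_proj _ ?_ (fun r ↦ (M.proj r).prodMap (N.proj r)) ?_ ?_
    · rw [eq_top_iff]
      have hM : Submodule.map (LinearMap.inl ℂ M N) ⊤ ≤ ⨆ r, (M.grade r).prod (N.grade r) := by
        rw [← M.isInternal.submodule_iSup_eq_top, Submodule.map_iSup]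
        refine iSup_mono fun r ↦ ?_
        rintro _ ⟨m, hm, rfl⟩
        exact ⟨hm, zero_mem _⟩
      have hN : Submodule.map (LinearMap.inr ℂ M N) ⊤ ≤ ⨆ r, (M.grade r).prod (N.grade r) := by
        rw [← N.isInternal.submodule_iSup_eq_top, Submodule.map_iSup]
        refine iSup_mono fun r ↦ ?_
        rintro _ ⟨m, hm, rfl⟩
        exact ⟨zero_mem _, hm⟩
      rintro ⟨m, n⟩ -
      have : (m, n) = LinearMap.inl ℂ M N m + LinearMap.inr ℂ M N n := by simp
      rw [this]
      exact add_mem (hM ⟨m, trivial, rfl⟩) (hN ⟨n, trivial, rfl⟩)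
    · rintro r ⟨m, n⟩ ⟨hm, hn⟩
      exact Prod.ext ((proj_of_mem r r _ hm).trans (if_pos rfl))
        ((proj_of_mem r r _ hn).trans (if_pos rfl))
    · rintro r s h ⟨m, n⟩ ⟨hm, hn⟩
      exact Prod.ext ((proj_of_mem r s _ hm).trans (if_neg h))
        ((proj_of_mem r s _ hn).trans (if_neg h))
  lie_mem n r x m hx hm := ⟨M.lie_mem n r x m.1 hx hm.1, N.lie_mem n r x m.2 hx hm.2⟩
  finite r := Module.Finite.iff_fg.mpr
    ((Module.Finite.iff_fg.mp (M.finite r)).prod (Module.Finite.iff_fg.mp (N.finite r)))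

/-- The direct sum of two modules, as a biproduct. -/
def prodBicone (M N : GrLieMod.{u, w} 𝒶) : BinaryBicone M N where
  pt := prod M N
  fst := (⟨{ LinearMap.fst ℂ M N with map_lie' := rfl }, fun _ _ h ↦ h.1⟩ : Hom (prod M N) M)
  snd := (⟨{ LinearMap.snd ℂ M N with map_lie' := rfl }, fun _ _ h ↦ h.2⟩ : Hom (prod M N) N)
  inl := (⟨{ LinearMap.inl ℂ M N with
      map_lie' := fun {x m} ↦ Prod.ext rfl (lie_zero x).symm },
    fun _ _ h ↦ ⟨h, zero_mem _⟩⟩ : Hom M (prod M N))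
  inr := (⟨{ LinearMap.inr ℂ M N with
      map_lie' := fun {x m} ↦ Prod.ext (lie_zero x).symm rfl },
    fun _ _ h ↦ ⟨zero_mem _, h⟩⟩ : Hom N (prod M N))
  inl_fst := rfl
  inl_snd := rfl
  inr_fst := rfl
  inr_snd := rfl

instance : HasBinaryBiproducts (GrLieMod.{u, w} 𝒶) where
  has_binary_biproduct M N := hasBinaryBiproduct_of_total (prodBicone M N) (by
    ext m
    exact Prod.ext (add_zero m.1) (zero_add m.2))

instance : HasFiniteProducts (GrLieMod.{u, w} 𝒶) :=
  hasFiniteProducts_of_has_binary_and_terminal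

noncomputable instance : Abelian (GrLieMod.{u, w} 𝒶) where

end GrLieMod


theorem weyl_exists_invariant_aux {g : Type*} [LieRing g] [LieAlgebra ℂ g]
    [FiniteDimensional ℂ g] [LieAlgebra.IsSemisimple ℂ g] (n : ℕ) :
    ∀ (W : Type*) [AddCommGroup W] [Module ℂ W] [LieRingModule g W] [LieModule ℂ g W]
      [FiniteDimensional ℂ W] (W₀ : Submodule ℂ W) (_ : ∀ (x : g) (w : W), ⁅x, w⁆ ∈ W₀)
      (w₁ : W) (_ : w₁ ∉ W₀) (_ : Module.finrank ℂ W ≤ n),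
      ∃ w ∉ W₀, ∀ x : g, ⁅x, w⁆ = 0 := by
  induction n with
  | zero =>
    intro W _ _ _ _ _ W₀ _ w₁ hw₁ hn
    have : Subsingleton W := (Module.finrank_zero_iff (R := ℂ)).mp (by omega)
    exact absurd (by rw [Subsingleton.elim w₁ 0]; exact zero_mem _) hw₁
  | succ n ih =>
    intro W _ _ _ _ _ W₀ hW₀ w₁ hw₁ hn
    have hperf : ⁅(⊤ : LieIdeal ℂ g), (⊤ : LieIdeal ℂ g)⁆ = ⊤ := by
      set D : LieIdeal ℂ g := ⁅(⊤ : LieIdeal ℂ g), (⊤ : LieIdeal ℂ g)⁆ with hD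
      have hab : IsLieAbelian (Dᶜ : LieIdeal ℂ g) := by
        refine ⟨fun x y ↦ Subtype.ext ?_⟩
        have h1 : ⁅(x : g), (y : g)⁆ ∈ D :=
          LieSubmodule.lie_mem_lie (LieSubmodule.mem_top _) (LieSubmodule.mem_top _)
        have h2 : ⁅(x : g), (y : g)⁆ ∈ Dᶜ := LieSubmodule.lie_mem _ y.2
        have := (LieSubmodule.mem_inf _ _ _).mpr ⟨h1, h2⟩
        rw [(isCompl_compl (x := D)).inf_eq_bot] at this
        simpa using this
      have : (Dᶜ : LieIdeal ℂ g) = ⊥ :=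
        LieAlgebra.HasTrivialRadical.eq_bot_of_isSolvable (Dᶜ : LieIdeal ℂ g)
      simpa using this
    by_cases htr : LieModule.traceForm ℂ g W = 0
    · have hnil := LieModule.isNilpotent_derivedSeries_of_traceForm_eq_zero (R := ℂ) htr
      have hD : LieAlgebra.derivedSeries ℂ g 1 = ⊤ := by
        simpa [LieAlgebra.derivedSeries_def] using hperf
      have hnil' : LieModule.IsNilpotent g W := by
        rw [LieModule.isNilpotent_iff_forall' (R := ℂ)] at hnil ⊢
        intro x
        exact hnil ⟨x, by rw [hD]; trivial⟩
      refine ⟨w₁, hw₁, ?_⟩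
      set A := ⁅(⊤ : LieIdeal ℂ g), (⊤ : LieSubmodule ℂ g W)⁆ with hA
      have hAA : A ≤ ⁅(⊤ : LieIdeal ℂ g), A⁆ := by
        have key : ∀ x ∈ (⁅(⊤ : LieIdeal ℂ g), (⊤ : LieIdeal ℂ g)⁆ : LieIdeal ℂ g), ∀ w : W,
            ⁅x, w⁆ ∈ ⁅(⊤ : LieIdeal ℂ g), A⁆ := by
          intro x hx
          rw [← LieSubmodule.mem_toSubmodule, LieSubmodule.lieIdeal_oper_eq_linear_span'] at hx
          induction hx using Submodule.span_induction with
          | mem x h =>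
            obtain ⟨y, -, z, -, rfl⟩ := h
            intro w
            rw [lie_lie]
            exact sub_mem
              (LieSubmodule.lie_mem_lie (LieSubmodule.mem_top _)
                (LieSubmodule.lie_mem_lie (LieSubmodule.mem_top _) (LieSubmodule.mem_top _)))
              (LieSubmodule.lie_mem_lie (LieSubmodule.mem_top _)
                (LieSubmodule.lie_mem_lie (LieSubmodule.mem_top _) (LieSubmodule.mem_top _)))
          | zero => intro w; simp
          | add x y _ _ hx hy => intro w; rw [add_lie]; exact add_mem (hx w) (hy w)
          | smul t x _ hx => intro w; rw [smul_lie]; exact SMulMemClass.smul_mem t (hx w)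
        rw [hA, LieSubmodule.lieIdeal_oper_eq_span, LieSubmodule.lieSpan_le]
        rintro _ ⟨x, w, rfl⟩
        exact key x (by rw [hperf]; trivial) w
      have hlcs : ∀ k, A ≤ LieModule.lowerCentralSeries ℂ g W k := by
        intro k
        induction k with
        | zero => simp
        | succ k ihk =>
          rw [LieModule.lowerCentralSeries_succ]
          exact hAA.trans (LieSubmodule.mono_lie le_rfl ihk)
      obtain ⟨k, hk⟩ := (LieModule.isNilpotent_iff ℂ g W).mp hnil'
      have hA0 : A = ⊥ := le_bot_iff.mp (hk ▸ hlcs k)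
      intro x
      have : ⁅x, w₁⁆ ∈ A :=
        LieSubmodule.lie_mem_lie (LieSubmodule.mem_top _) (LieSubmodule.mem_top _)
      rw [hA0] at this
      simpa using this
    · set β := LieModule.traceForm ℂ g W with hβ
      let I : LieIdeal ℂ g :=
        { LinearMap.ker β with
          lie_mem := by
            intro x y hy
            have hy' : β y = 0 := hy
            change β ⁅x, y⁆ = 0
            ext z
            rw [← lie_skew, map_neg, LinearMap.neg_apply, hβ, LieModule.traceForm_apply_lie_apply,
              ← hβ, hy']
            simp }
      let J : LieIdeal ℂ g := Iᶜ
      have hIJ : IsCompl I J := isCompl_compl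
      have hdec : ∀ z : g, ∃ a ∈ I, ∃ b ∈ J, a + b = z := by
        intro z
        have : z ∈ I ⊔ J := by rw [hIJ.sup_eq_top]; trivial
        exact (LieSubmodule.mem_sup _ _ _).mp this
      have hI : ∀ a ∈ I, ∀ z, β a z = 0 := fun a ha z ↦ by
        have : β a = 0 := ha
        simp [this]
      have hsymm : ∀ x y, β x y = β y x := LieModule.traceForm_comm ℂ g W
      let βJ : LinearMap.BilinForm ℂ J := β.domRestrict₁₂ J.toSubmodule J.toSubmodule
      have hβJ : ∀ x y : J, βJ x y = β x y := fun _ _ ↦ rfl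
      have hnd : ∀ x : J, (∀ y : J, βJ x y = 0) → x = 0 := by
        intro x hx
        have hxI : (x : g) ∈ I := by
          change β x = 0
          ext z
          obtain ⟨a, ha, b, hb, rfl⟩ := hdec z
          have := hx ⟨b, hb⟩
          rw [hβJ] at this
          simp only [map_add, LinearMap.zero_apply]
          rw [hsymm, hI a ha, this, add_zero]
        have := (LieSubmodule.mem_inf _ _ _).mpr ⟨hxI, x.2⟩
        rw [hIJ.inf_eq_bot] at this
        exact Subtype.ext (by simpa using this)
      have hsymJ : βJ.IsSymm := ⟨fun x y ↦ hsymm x y⟩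
      have hndJ : βJ.Nondegenerate := by
        refine ⟨fun x hx ↦ hnd x hx, fun x hx ↦ hnd x fun y ↦ ?_⟩
        rw [hβJ, hsymm, ← hβJ]
        exact hx y
      let b := Module.finBasis ℂ J
      let d := βJ.dualBasis hndJ b
      have hd1 : ∀ i j, β (d i) (b j) = if j = i then 1 else 0 := fun i j ↦
        LinearMap.BilinForm.apply_dualBasis_left hndJ b i j
      let φ := LieModule.toEnd ℂ g W
      let c : Module.End ℂ W := ∑ i, φ (b i) * φ (d i)
      have hbz : ∀ (z : g) i, ⁅z, (b i : g)⁆ = ∑ j, β ⁅z, (b i : g)⁆ (d j) • (b j : g) := by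
        intro z i
        have h1 := b.sum_repr ⟨⁅z, (b i : g)⁆, J.lie_mem (b i).2⟩
        have h2 : ∀ x : J, ∀ j, b.repr x j = β x (d j) := by
          intro x j
          have h3 : ∀ i j, βJ (d i) (b j) = if j = i then 1 else 0 := hd1
          have h4 := congrArg (βJ (d j)) (b.sum_repr x)
          rw [map_sum] at h4
          simp only [map_smul, h3, smul_eq_mul, mul_ite, mul_one, mul_zero,
            Finset.sum_ite_eq', Finset.mem_univ, if_true] at h4
          rw [h4, hβJ, hsymm]
        refine (congrArg Subtype.val h1).symm.trans ?_
        simp [h2]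
      have hdz : ∀ (z : g) i, ⁅z, (d i : g)⁆ = ∑ j, β ⁅z, (d i : g)⁆ (b j) • (d j : g) := by
        intro z i
        have h1 := d.sum_repr ⟨⁅z, (d i : g)⁆, J.lie_mem (d i).2⟩
        have h2 : ∀ x : J, ∀ j, d.repr x j = β x (b j) := fun x j ↦
          LinearMap.BilinForm.dualBasis_repr_apply hndJ b x j
        refine (congrArg Subtype.val h1).symm.trans ?_
        simp [h2]
      have hcomm : ∀ (z : g) (w : W), c ⁅z, w⁆ = ⁅z, c w⁆ := by
        intro z w
        have e : ∀ i, ⁅z, ⁅(b i : g), ⁅(d i : g), w⁆⁆⁆ - ⁅(b i : g), ⁅(d i : g), ⁅z, w⁆⁆⁆ =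
            ⁅⁅z, (b i : g)⁆, ⁅(d i : g), w⁆⁆ + ⁅(b i : g), ⁅⁅z, (d i : g)⁆, w⁆⁆ := by
          intro i
          rw [lie_lie z (b i : g), lie_lie z (d i : g), lie_sub]
          abel
        have e2 : ∑ i, (⁅⁅z, (b i : g)⁆, ⁅(d i : g), w⁆⁆ + ⁅(b i : g), ⁅⁅z, (d i : g)⁆, w⁆⁆) = 0 := by
          rw [Finset.sum_add_distrib]
          have l : ∀ i, ⁅⁅z, (b i : g)⁆, ⁅(d i : g), w⁆⁆ =
              ∑ j, β ⁅z, (b i : g)⁆ (d j) • ⁅(b j : g), ⁅(d i : g), w⁆⁆ := by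
            intro i
            conv_lhs => rw [hbz z i]
            simp [sum_lie]
          have r : ∀ i, ⁅(b i : g), ⁅⁅z, (d i : g)⁆, w⁆⁆ =
              ∑ j, β ⁅z, (d i : g)⁆ (b j) • ⁅(b i : g), ⁅(d j : g), w⁆⁆ := by
            intro i
            conv_lhs => rw [hdz z i]
            simp [sum_lie, lie_sum]
          simp_rw [l, r]
          rw [Finset.sum_comm, ← Finset.sum_add_distrib]
          refine Finset.sum_eq_zero fun i _ ↦ ?_
          rw [← Finset.sum_add_distrib]
          refine Finset.sum_eq_zero fun j _ ↦ ?_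
          rw [← add_smul]
          have : β ⁅z, (b j : g)⁆ (d i) + β ⁅z, (d i : g)⁆ (b j) = 0 := by
            rw [← lie_skew, map_neg, LinearMap.neg_apply, hβ, LieModule.traceForm_apply_lie_apply,
              ← hβ, hsymm]
            simp
          rw [this, zero_smul]
        have e3 : ⁅z, c w⁆ - c ⁅z, w⁆ = 0 := by
          rw [← e2, ← Finset.sum_congr rfl fun i _ ↦ e i, Finset.sum_sub_distrib]
          simp [c, φ, LinearMap.sum_apply, lie_sum]
        exact (sub_eq_zero.mp e3).symm
      have hcW : ∀ w, c w ∈ W₀ := by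
        intro w
        simp only [c, LinearMap.sum_apply, Module.End.mul_apply]
        exact Submodule.sum_mem _ fun i _ ↦ hW₀ _ _
      have htrc : LinearMap.trace ℂ W c = Module.finrank ℂ J := by
        have : ∀ i, LinearMap.trace ℂ W (φ (b i) * φ (d i)) = 1 := by
          intro i
          have := hd1 i i
          rw [hsymm, if_pos rfl] at this
          exact this
        simp [c, this]
      have hJ : Module.finrank ℂ J ≠ 0 := by
        intro h0
        have : Subsingleton J := (Module.finrank_zero_iff (R := ℂ)).mp h0
        apply htr
        ext z
        obtain ⟨a, ha, y, hy, rfl⟩ := hdec z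
        have : y = 0 := congrArg Subtype.val (Subsingleton.elim (⟨y, hy⟩ : J) 0)
        subst this
        simp [hI a ha]
      obtain ⟨k, hk⟩ := (c.eventually_isCompl_ker_pow_range_pow.and
        (Filter.eventually_ge_atTop 1)).exists
      obtain ⟨hk, hk1⟩ := hk
      have hrange : LinearMap.range (c ^ k) ≤ W₀ := by
        rintro _ ⟨w, rfl⟩
        obtain ⟨k, rfl⟩ := Nat.exists_eq_add_of_le' hk1
        rw [pow_succ', Module.End.mul_apply]
        exact hcW _
      have hcommk : ∀ (m : ℕ) (z : g) (w : W), (c ^ m) ⁅z, w⁆ = ⁅z, (c ^ m) w⁆ := by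
        intro m z
        induction m with
        | zero => intro w; simp
        | succ m ihm => intro w; rw [pow_succ, Module.End.mul_apply, hcomm, ihm]; rfl
      let K : LieSubmodule ℂ g W :=
        { LinearMap.ker (c ^ k) with
          lie_mem := by
            intro z w hw
            have hw' : (c ^ k) w = 0 := hw
            change (c ^ k) ⁅z, w⁆ = 0
            rw [hcommk, hw', lie_zero] }
      have hlt : Module.finrank ℂ K < Module.finrank ℂ W := by
        refine Submodule.finrank_lt (s := LinearMap.ker (c ^ k)) ?_
        intro htop
        have hc0 : c ^ k = 0 := LinearMap.ker_eq_top.mp htop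
        have := LinearMap.isNilpotent_trace_of_isNilpotent (R := ℂ) (⟨k, hc0⟩ : IsNilpotent c)
        rw [htrc] at this
        exact hJ (by exact_mod_cast this.eq_zero)
      obtain ⟨p, hp, q, hq, hpq⟩ : ∃ p ∈ LinearMap.ker (c ^ k), ∃ q ∈ LinearMap.range (c ^ k),
          p + q = w₁ := by
        refine Submodule.mem_sup.mp ?_
        rw [hk.sup_eq_top]; trivial
      have hpW : p ∉ W₀ := fun h ↦ hw₁ (hpq ▸ add_mem h (hrange hq))
      obtain ⟨w, hw, hinv⟩ := ih K (W₀.comap K.toSubmodule.subtype) (fun x w ↦ hW₀ x w) ⟨p, hp⟩ hpW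
        (by omega)
      exact ⟨w, hw, fun x ↦ congrArg Subtype.val (hinv x)⟩


theorem weyl_lift {g : Type*} [LieRing g] [LieAlgebra ℂ g]
    [FiniteDimensional ℂ g] [LieAlgebra.IsSemisimple ℂ g]
    {L A C : Type*} [AddCommGroup L] [Module ℂ L] [LieRingModule g L] [LieModule ℂ g L]
    [FiniteDimensional ℂ L] [AddCommGroup A] [Module ℂ A] [LieRingModule g A] [LieModule ℂ g A]
    [FiniteDimensional ℂ A] [AddCommGroup C] [Module ℂ C] [LieRingModule g C] [LieModule ℂ g C]
    (π : A →ₗ⁅ℂ,g⁆ C) (hπ : Function.Surjective π) (f : L →ₗ⁅ℂ,g⁆ C) :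
    ∃ F : L →ₗ⁅ℂ,g⁆ A, ∀ m, π (F m) = f m := by
  by_cases hf : f = 0
  · exact ⟨0, fun m ↦ by simp [hf]⟩
  let W : LieSubmodule ℂ g (L →ₗ[ℂ] A) :=
    { carrier := {φ | ∃ c : ℂ, ∀ m, π (φ m) = c • f m}
      add_mem' := by
        rintro φ ψ ⟨c, hc⟩ ⟨d, hd⟩
        exact ⟨c + d, fun m ↦ by simp [hc, hd, add_smul]⟩
      zero_mem' := ⟨0, fun m ↦ by simp⟩
      smul_mem' := by
        rintro t φ ⟨c, hc⟩
        exact ⟨t * c, fun m ↦ by simp [hc, mul_smul]⟩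
      lie_mem := by
        rintro x φ ⟨c, hc⟩
        exact ⟨0, fun m ↦ by simp [hc]⟩ }
  let W₀ : Submodule ℂ W :=
    { carrier := {φ | ∀ m, π ((φ : L →ₗ[ℂ] A) m) = 0}
      add_mem' := by
        intro φ ψ h h' m
        simp [h m, h' m]
      zero_mem' := fun m ↦ by simp
      smul_mem' := by
        intro t φ h m
        simp [h m] }
  obtain ⟨s, hs⟩ := LinearMap.exists_rightInverse_of_surjective (π : A →ₗ[ℂ] C)
    (LinearMap.range_eq_top.mpr hπ)
  have hs' : ∀ y, π (s y) = y := fun y ↦ LinearMap.congr_fun hs y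
  obtain ⟨φ, hφ, hinv⟩ := weyl_exists_invariant_aux (g := g) _ W W₀
    (by
      rintro x ⟨φ, c, hc⟩ m
      simp [hc])
    ⟨s ∘ₗ (f : L →ₗ[ℂ] C), 1, fun m ↦ by simp [hs']⟩
    (by
      intro h
      apply hf
      ext m
      have := h m
      simpa [hs'] using this)
    le_rfl
  obtain ⟨φ, c, hc⟩ := φ
  have hc0 : c ≠ 0 := by
    rintro rfl
    exact hφ fun m ↦ by simp [hc]
  have hφ' : ∀ (x : g) m, φ ⁅x, m⁆ = ⁅x, φ m⁆ := by
    intro x m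
    have := LinearMap.congr_fun (congrArg Subtype.val (hinv x)) m
    simp only [LieSubmodule.coe_bracket, LieHom.lie_apply, LieSubmodule.coe_zero,
      LinearMap.zero_apply] at this
    exact (sub_eq_zero.mp this).symm
  exact ⟨{ c⁻¹ • φ with map_lie' := by intro x m; simp [hφ'] }, fun m ↦ by
    change π (c⁻¹ • φ m) = f m
    rw [map_smul, hc, smul_smul, inv_mul_cancel₀ hc0, one_smul]⟩

section HighestWeight

variable {g : Type u} [LieRing g] [LieAlgebra ℂ g] [FiniteDimensional ℂ g]
  [LieAlgebra.IsSemisimple ℂ g] {H : LieSubalgebra ℂ g} [H.IsCartanSubalgebra]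

/-- `L` is a simple `g`-module with highest weight `lam`, with respect to the Cartan subalgebra `H`
and the set of simple roots `b`: it is irreducible and contains a nonzero vector of weight `lam`
which is annihilated by the root spaces of all positive roots, i.e. by `𝔫⁺`. -/
def IsSimpleOfHighestWeight (b : (LieAlgebra.IsKilling.rootSystem H).Base)
    (lam : Module.Dual ℂ H) (L : Type w) [AddCommGroup L] [Module ℂ L] [LieRingModule g L]
    [LieModule ℂ g L] : Prop :=
  LieModule.IsIrreducible ℂ g L ∧
    ∃ v : L, v ≠ 0 ∧ (∀ h : H, ⁅(h : g), v⁆ = lam h • v) ∧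
      ∀ α : H.root, b.IsPos α → ∀ x ∈ LieAlgebra.rootSpace H (α : LieModule.Weight ℂ H g), ⁅x, v⁆ = 0

/-- The set `P⁺` of dominant integral weights: the `λ` with `λ(hᵢ) ∈ ℤ_{≥ 0}` for all simple
coroots `hᵢ`, i.e. the `ℤ_{≥ 0}`-combinations of the fundamental weights. -/
def dominantWeights (b : (LieAlgebra.IsKilling.rootSystem H).Base) : Set (Module.Dual ℂ H) :=
  {lam | ∀ i ∈ b.support, ∃ n : ℕ, lam ((LieAlgebra.IsKilling.rootSystem H).coroot i) = n}

theorem isPos_mem_closure (b : (LieAlgebra.IsKilling.rootSystem H).Base) (α : H.root)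
    (hα : b.IsPos α) : (LieAlgebra.IsKilling.rootSystem H).root α ∈
      AddSubmonoid.closure ((LieAlgebra.IsKilling.rootSystem H).root '' b.support) := by
  refine RootPairing.Base.IsPos.induction_on_add (b := b) hα
    (p := fun α ↦ (LieAlgebra.IsKilling.rootSystem H).root α ∈
      AddSubmonoid.closure ((LieAlgebra.IsKilling.rootSystem H).root '' b.support)) ?_ ?_
  · intro i hi
    exact AddSubmonoid.subset_closure ⟨i, hi, rfl⟩
  · intro i j k hk hi hj
    rw [hk]
    exact add_mem hi (AddSubmonoid.subset_closure ⟨j, hj, rfl⟩)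

theorem isSimpleOfHighestWeight_sub_mem {b : (LieAlgebra.IsKilling.rootSystem H).Base}
    {lam mu : Module.Dual ℂ H} {L : Type w} [AddCommGroup L] [Module ℂ L] [LieRingModule g L]
    [LieModule ℂ g L] [FiniteDimensional ℂ L] (h1 : IsSimpleOfHighestWeight b lam L)
    (w : L) (hw0 : w ≠ 0) (hw : ∀ h : H, ⁅(h : g), w⁆ = mu h • w) :
    ∃ β ∈ AddSubmonoid.closure ((LieAlgebra.IsKilling.rootSystem H).root '' b.support),
      mu + β = lam := by
  obtain ⟨hirr, v, hv0, hvH, hvn⟩ := h1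
  set Q := AddSubmonoid.closure ((LieAlgebra.IsKilling.rootSystem H).root '' b.support)
  -- the smallest subspace which contains `v` and is stable under the negative root vectors
  let S : Submodule ℂ L := sInf {S | v ∈ S ∧ ∀ α : H.root, ¬ b.IsPos α →
    ∀ x ∈ LieAlgebra.rootSpace H (α : LieModule.Weight ℂ H g), ∀ m ∈ S, ⁅x, m⁆ ∈ S}
  have hvS : v ∈ S := Submodule.mem_sInf.mpr fun S hS ↦ hS.1
  have hneg : ∀ α : H.root, ¬ b.IsPos α →
      ∀ x ∈ LieAlgebra.rootSpace H (α : LieModule.Weight ℂ H g), ∀ m ∈ S, ⁅x, m⁆ ∈ S := by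
    intro α hα x hx m hm
    refine Submodule.mem_sInf.mpr fun S' hS' ↦ hS'.2 α hα x hx m ?_
    exact Submodule.mem_sInf.mp hm S' hS'
  have hvg : ∀ x : g, ⁅x, v⁆ ∈ S := by
    intro x
    have hx : x ∈ (⨆ χ : LieModule.Weight ℂ H g, LieModule.genWeightSpace g χ :
        LieSubmodule ℂ H g) := by
      rw [LieModule.iSup_genWeightSpace_eq_top' ℂ H g]; trivial
    induction hx using LieSubmodule.iSup_induction' with
    | mem χ x hx =>
      by_cases hχ : χ.IsZero
      · have h0 : x ∈ H := by
          have : x ∈ LieAlgebra.rootSpace H (0 : H → ℂ) := by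
            have e : (χ : H → ℂ) = 0 := hχ
            rw [← e]; exact hx
          rw [LieAlgebra.rootSpace_zero_eq] at this
          exact this
        rw [hvH ⟨x, h0⟩]
        exact S.smul_mem _ hvS
      · have hmem : χ ∈ H.root := by simpa using hχ
        by_cases hp : b.IsPos ⟨χ, hmem⟩
        · rw [hvn ⟨χ, hmem⟩ hp x hx]; exact zero_mem _
        · exact hneg ⟨χ, hmem⟩ hp x hx v hvS
    | zero => simp
    | add x y _ _ hx hy => rw [add_lie]; exact add_mem hx hy
  have hSg : ∀ (x : g) (m : L), m ∈ S → ⁅x, m⁆ ∈ S := by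
    let S' : Submodule ℂ L :=
      { carrier := {m | m ∈ S ∧ ∀ x : g, ⁅x, m⁆ ∈ S}
        add_mem' := fun hx hy ↦ ⟨add_mem hx.1 hy.1, fun x ↦ by
          rw [lie_add]; exact add_mem (hx.2 x) (hy.2 x)⟩
        zero_mem' := ⟨zero_mem _, fun x ↦ by simp⟩
        smul_mem' := fun c x hx ↦ ⟨S.smul_mem c hx.1, fun y ↦ by
          rw [lie_smul]; exact S.smul_mem c (hx.2 y)⟩ }
    have hle : S ≤ S' := sInf_le ⟨⟨hvS, hvg⟩, fun α hα x hx m hm ↦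
      ⟨hneg α hα x hx m hm.1, fun z ↦ by
        rw [leibniz_lie]
        exact add_mem (hm.2 _) (hneg α hα x hx _ (hm.2 z))⟩⟩
    exact fun x m hm ↦ (hle hm).2 x
  have hStop : S = ⊤ := by
    let S' : LieSubmodule ℂ g L := { S with lie_mem := fun {x m} hm ↦ hSg x m hm }
    have : S' = ⊤ := by
      refine (IsSimpleOrder.eq_bot_or_eq_top S').resolve_left fun h ↦ hv0 ?_
      have : v ∈ S' := hvS
      rwa [h, LieSubmodule.mem_bot] at this
    exact congrArg LieSubmodule.toSubmodule this
  let T : LieSubmodule ℂ H L := ⨆ β : Q, LieModule.genWeightSpace L (lam - (β : Module.Dual ℂ H))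
  have hST : S ≤ T.toSubmodule := by
    refine sInf_le ⟨?_, ?_⟩
    · refine LieSubmodule.mem_iSup_of_mem (⟨0, zero_mem _⟩ : Q) ?_
      apply LieModule.weightSpace_le_genWeightSpace
      rw [LieModule.mem_weightSpace]
      intro h
      simpa using hvH h
    · intro α hα x hx m hm
      induction hm using LieSubmodule.iSup_induction' with
      | mem β m hm =>
        have h := LieAlgebra.lie_mem_genWeightSpace_of_mem_genWeightSpace hx hm
        have hα' : -(LieAlgebra.IsKilling.rootSystem H).root α ∈ Q := by
          have := isPos_mem_closure b ((LieAlgebra.IsKilling.rootSystem H).indexNeg.neg α)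
            (((RootPairing.Base.IsPos.neg_iff_not b α)).mpr hα)
          have e : (LieAlgebra.IsKilling.rootSystem H).root
              ((LieAlgebra.IsKilling.rootSystem H).indexNeg.neg α) =
              -(LieAlgebra.IsKilling.rootSystem H).root α :=
            by
              rw [RootPairing.indexNeg_neg, RootPairing.root_reflectionPerm,
                RootPairing.reflection_apply_self]
          rwa [e] at this
        refine LieSubmodule.mem_iSup_of_mem (⟨_, add_mem β.2 hα'⟩ : Q) ?_
        convert h using 2
        ext h
        simp
        ring
      | zero => simp
      | add x y _ _ hx hy => rw [lie_add]; exact add_mem hx hy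
  by_contra hcon
  push Not at hcon
  have hind := LieModule.iSupIndep_genWeightSpace ℂ H L (mu : H → ℂ)
  have hw1 : w ∈ LieModule.genWeightSpace L (mu : H → ℂ) := by
    apply LieModule.weightSpace_le_genWeightSpace
    rw [LieModule.mem_weightSpace]
    exact hw
  have hw2 : w ∈ (⨆ (χ : H → ℂ) (_ : χ ≠ mu), LieModule.genWeightSpace L χ :
      LieSubmodule ℂ H L) := by
    have hT : T ≤ ⨆ (χ : H → ℂ) (_ : χ ≠ mu), LieModule.genWeightSpace L χ := by
      refine iSup_le fun β ↦ ?_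
      refine le_iSup₂_of_le (lam - (β : Module.Dual ℂ H) : H → ℂ) ?_ le_rfl
      intro h
      refine hcon β β.2 ?_
      ext x
      have := congrFun h x
      simp only [Pi.sub_apply] at this
      simp [← this]
    apply hT
    apply hST
    rw [hStop]; trivial
  have := (disjoint_iff_inf_le.mp hind) ((LieSubmodule.mem_inf _ _ _).mpr ⟨hw1, hw2⟩)
  exact hw0 (by simpa using this)

/-- The highest weight of a simple module is unique. -/
theorem isSimpleOfHighestWeight_unique {b : (LieAlgebra.IsKilling.rootSystem H).Base}
    {lam mu : Module.Dual ℂ H} {L : Type w} [AddCommGroup L] [Module ℂ L] [LieRingModule g L]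
    [LieModule ℂ g L] [FiniteDimensional ℂ L] (h1 : IsSimpleOfHighestWeight b lam L)
    (h2 : IsSimpleOfHighestWeight b mu L) : lam = mu := by
  obtain ⟨-, v, hv0, hv, -⟩ := id h1
  obtain ⟨-, w, hw0, hw, -⟩ := id h2
  obtain ⟨β, hβ, e1⟩ := isSimpleOfHighestWeight_sub_mem h1 w hw0 hw
  obtain ⟨γ, hγ, e2⟩ := isSimpleOfHighestWeight_sub_mem h2 v hv0 hv
  let f : Module.Dual ℂ H →ₗ[ℂ] ℂ := b.toWeightBasis.constr ℂ fun _ ↦ (1 : ℂ)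
  have hf : ∀ β ∈ AddSubmonoid.closure ((LieAlgebra.IsKilling.rootSystem H).root '' b.support),
      ∃ n : ℕ, f β = n ∧ (n = 0 → β = 0) := by
    intro β hβ
    induction hβ using AddSubmonoid.closure_induction with
    | mem x hx =>
      obtain ⟨i, hi, rfl⟩ := hx
      refine ⟨1, ?_, by simp⟩
      have := b.toWeightBasis.constr_basis ℂ (fun _ ↦ (1 : ℂ)) ⟨i, hi⟩
      rw [RootPairing.Base.toWeightBasis_apply] at this
      rw [Nat.cast_one]
      exact this
    | zero => exact ⟨0, by simp⟩
    | add x y _ _ hx hy =>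
      obtain ⟨n, hn, hn0⟩ := hx
      obtain ⟨m, hm, hm0⟩ := hy
      refine ⟨n + m, by simp [hn, hm], fun h ↦ ?_⟩
      rw [hn0 (by omega), hm0 (by omega), add_zero]
  obtain ⟨n, hn, hn0⟩ := hf β hβ
  obtain ⟨m, hm, hm0⟩ := hf γ hγ
  have hsum : β + γ = 0 := by
    have : mu + (β + γ) = mu := by rw [← add_assoc, e1, e2]
    simpa using this
  have : (n : ℂ) + m = 0 := by rw [← hn, ← hm, ← map_add, hsum, map_zero]
  have hnm : n + m = 0 := by exact_mod_cast this
  rw [← e1, hn0 (by omega), add_zero]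

end HighestWeight

section SemidirectProduct

/-- The semidirect product `g ⋉ V` of a Lie algebra `g` with a `g`-module `V`, regarded as an
abelian ideal. -/
def SemidirectLie (g : Type u) (V : Type v) : Type (max u v) := g × V

variable {g : Type u} [LieRing g] [LieAlgebra ℂ g]
  {V : Type v} [AddCommGroup V] [Module ℂ V] [LieRingModule g V] [LieModule ℂ g V]

namespace SemidirectLie

instance : AddCommGroup (SemidirectLie g V) := inferInstanceAs (AddCommGroup (g × V))

instance : Module ℂ (SemidirectLie g V) := inferInstanceAs (Module ℂ (g × V))

instance : Bracket (SemidirectLie g V) (SemidirectLie g V) where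
  bracket x y := (⁅x.1, y.1⁆, ⁅x.1, y.2⁆ - ⁅y.1, x.2⁆)

instance : LieRing (SemidirectLie g V) where
  add_lie x y z := Prod.ext (add_lie _ _ _) (by
    change ⁅x.1 + y.1, z.2⁆ - ⁅z.1, x.2 + y.2⁆ = (⁅x.1, z.2⁆ - ⁅z.1, x.2⁆) + (⁅y.1, z.2⁆ - ⁅z.1, y.2⁆)
    rw [add_lie, lie_add]; abel)
  lie_add x y z := Prod.ext (lie_add _ _ _) (by
    change ⁅x.1, y.2 + z.2⁆ - ⁅y.1 + z.1, x.2⁆ = (⁅x.1, y.2⁆ - ⁅y.1, x.2⁆) + (⁅x.1, z.2⁆ - ⁅z.1, x.2⁆)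
    rw [add_lie, lie_add]; abel)
  lie_self x := Prod.ext (lie_self _) (sub_self _)
  leibniz_lie x y z := Prod.ext (leibniz_lie _ _ _) (by
    change ⁅x.1, ⁅y.1, z.2⁆ - ⁅z.1, y.2⁆⁆ - ⁅⁅y.1, z.1⁆, x.2⁆ =
      (⁅⁅x.1, y.1⁆, z.2⁆ - ⁅z.1, ⁅x.1, y.2⁆ - ⁅y.1, x.2⁆⁆) +
        (⁅y.1, ⁅x.1, z.2⁆ - ⁅z.1, x.2⁆⁆ - ⁅⁅x.1, z.1⁆, y.2⁆)
    simp only [lie_sub, lie_lie]; abel)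

instance : LieAlgebra ℂ (SemidirectLie g V) where
  lie_smul c x y := Prod.ext (lie_smul _ _ _) (by
    change ⁅x.1, c • y.2⁆ - ⁅c • y.1, x.2⁆ = c • (⁅x.1, y.2⁆ - ⁅y.1, x.2⁆)
    rw [lie_smul, smul_lie, smul_sub])

variable (g V) in
/-- The inclusion of `g` in `g ⋉ V`. -/
def inl : g →ₗ⁅ℂ⁆ SemidirectLie g V :=
  { LinearMap.inl ℂ g V with
    map_lie' := fun {x y} ↦ Prod.ext rfl (by
      change (0 : V) = ⁅x, (0 : V)⁆ - ⁅y, (0 : V)⁆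
      simp) }

variable (g V) in
/-- The inclusion of `V` in `g ⋉ V`. -/
def inr : V →ₗ[ℂ] SemidirectLie g V := LinearMap.inr ℂ g V

variable (g V) in
/-- The projection of `g ⋉ V` onto `g`. -/
def fst : SemidirectLie g V →ₗ⁅ℂ⁆ g :=
  { LinearMap.fst ℂ g V with map_lie' := rfl }

variable (g V) in
/-- The grading of `a = g ⋉ V`: `g` in degree `0`, `V` in degree `1`. -/
def grading : ℕ → Submodule ℂ (SemidirectLie g V)
  | 0 => LinearMap.range (inl g V : g →ₗ[ℂ] SemidirectLie g V)
  | 1 => LinearMap.range (inr g V)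
  | _ => ⊥

end SemidirectLie

end SemidirectProduct

section Truncation

variable {g : Type u} [LieRing g] [LieAlgebra ℂ g]
  {V : Type v} [AddCommGroup V] [Module ℂ V] [LieRingModule g V] [LieModule ℂ g V]

variable (g V) in
/-- The category `Ĝ` of `ℤ`-graded modules over `a = g ⋉ V` with finite-dimensional graded
components; the morphisms are the `a`-module maps of degree `0`. -/
abbrev GHat := GrLieMod.{max u v, w} (SemidirectLie.grading g V)

namespace GHat

/-- The graded component `M[r]`, as a `g`-module. -/
def piece (M : GHat.{u, v, w} g V) (r : ℤ) : Type w := M.grade r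

instance (M : GHat.{u, v, w} g V) (r : ℤ) : AddCommGroup (M.piece r) :=
  inferInstanceAs (AddCommGroup (M.grade r))

instance (M : GHat.{u, v, w} g V) (r : ℤ) : Module ℂ (M.piece r) :=
  inferInstanceAs (Module ℂ (M.grade r))

instance (M : GHat.{u, v, w} g V) (r : ℤ) : FiniteDimensional ℂ (M.piece r) :=
  M.finite r

theorem inl_lie_mem (M : GHat.{u, v, w} g V) {r : ℤ} (x : g) {m : M} (hm : m ∈ M.grade r) :
    ⁅SemidirectLie.inl g V x, m⁆ ∈ M.grade r := by
  simpa using M.lie_mem 0 r _ m (⟨x, rfl⟩ : SemidirectLie.inl g V x ∈ SemidirectLie.grading g V 0) hm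

instance (M : GHat.{u, v, w} g V) (r : ℤ) : LieRingModule g (M.piece r) where
  bracket x m := ⟨⁅SemidirectLie.inl g V x, m.1⁆, M.inl_lie_mem x m.2⟩
  add_lie x y m := Subtype.ext (by
    change ⁅SemidirectLie.inl g V (x + y), m.1⁆ = _
    rw [map_add, add_lie]; rfl)
  lie_add x m n := Subtype.ext (lie_add _ m.1 n.1)
  leibniz_lie x y m := Subtype.ext (by
    change ⁅SemidirectLie.inl g V x, ⁅SemidirectLie.inl g V y, m.1⁆⁆ =
      ⁅SemidirectLie.inl g V ⁅x, y⁆, m.1⁆ + ⁅SemidirectLie.inl g V y, ⁅SemidirectLie.inl g V x, m.1⁆⁆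
    rw [LieHom.map_lie, leibniz_lie])

instance (M : GHat.{u, v, w} g V) (r : ℤ) : LieModule ℂ g (M.piece r) where
  smul_lie c x m := Subtype.ext (by
    change ⁅SemidirectLie.inl g V (c • x), m.1⁆ = c • ⁅SemidirectLie.inl g V x, m.1⁆
    rw [map_smul, smul_lie])
  lie_smul c x m := Subtype.ext (lie_smul c _ m.1)

/-- The `g`-module map `M[r] → N[r]` induced by a morphism `M ⟶ N`. -/
def mapPiece {M N : GHat.{u, v, w} g V} (f : M ⟶ N) (r : ℤ) : M.piece r →ₗ⁅ℂ,g⁆ N.piece r :=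
  { (f.toLie : M →ₗ[ℂ] N).restrict (f.map_grade r) with
    map_lie' := fun {x m} ↦ Subtype.ext (f.toLie.map_lie _ m.1) }

theorem mapPiece_injective {M N : GHat.{u, v, w} g V} (f : M ⟶ N)
    (hf : Function.Injective f.toLie) (r : ℤ) : Function.Injective (mapPiece f r) :=
  fun _ _ h ↦ Subtype.ext (hf (congrArg Subtype.val h))

theorem mapPiece_surjective {M N : GHat.{u, v, w} g V} (f : M ⟶ N)
    (hf : Function.Surjective f.toLie) (r : ℤ) : Function.Surjective (mapPiece f r) := by
  rintro ⟨n, hn⟩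
  obtain ⟨m, hm⟩ := hf n
  refine ⟨⟨M.proj r m, M.proj_mem r m⟩, Subtype.ext ?_⟩
  change f.toLie (M.proj r m) = n
  rw [GrLieMod.map_proj, hm, GrLieMod.proj_of_mem r r n hn, if_pos rfl]

variable (V) in
/-- For a finite-dimensional `g`-module `L`, the object `τ_r ev(L)` of `Ĝ`: it is `L` in degree `r`,
and `V` acts on it by zero. If `L` is the simple module `V(λ)`, this is `V(λ, r)`. -/
def shiftedEv (L : Type w) [AddCommGroup L] [Module ℂ L] [LieRingModule g L] [LieModule ℂ g L]
    [FiniteDimensional ℂ L] (r : ℤ) : GHat.{u, v, w} g V where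
  carrier := L
  lieRingModule := LieRingModule.compLieHom L (SemidirectLie.fst g V)
  lieModule := LieModule.compLieHom L (SemidirectLie.fst g V)
  grade k := if k = r then ⊤ else ⊥
  isInternal := by
    refine GrLieMod.isInternal_of_proj _ ?_ (fun k ↦ if k = r then LinearMap.id else 0) ?_ ?_
    · rw [eq_top_iff]
      exact le_iSup_of_le r (by simp)
    · intro k m hm
      split_ifs at hm ⊢ with h
      · rfl
      · simpa using hm.symm
    · intro k s hks m hm
      split_ifs with h
      · have hs : s ≠ r := fun h' ↦ hks (h.trans h'.symm)
        simpa [hs] using hm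
      · rfl
  lie_mem n k x m hx hm := by
    let _ := LieRingModule.compLieHom L (SemidirectLie.fst g V)
    by_cases hk : k = r
    · match n, hx with
      | 0, hx => simp [hk]
      | 1, ⟨y, hy⟩ =>
        have : ⁅x, m⁆ = (0 : L) := by
          subst hy
          exact zero_lie m
        rw [this]; exact zero_mem _
      | n + 2, hx =>
        have : ⁅x, m⁆ = (0 : L) := by
          have hx : x = 0 := hx
          subst hx
          exact zero_lie m
        rw [this]; exact zero_mem _
    · have : m = 0 := by simpa [hk] using hm
      rw [this]
      have h0 : ⁅x, (0 : L)⁆ = 0 := lie_zero (SemidirectLie.fst g V x)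
      rw [h0]
      exact zero_mem _
  finite _ := inferInstance

end GHat

variable [FiniteDimensional ℂ g] [LieAlgebra.IsSemisimple ℂ g]
  {H : LieSubalgebra ℂ g} [H.IsCartanSubalgebra]

/-- The index set `Λ = P⁺ × ℤ` of the simple objects. -/
abbrev SimpleIndex (b : (LieAlgebra.IsKilling.rootSystem H).Base) : Type u :=
  dominantWeights b × ℤ

variable (V) in
/-- The set `wt(a_n)` of weights of the graded piece `a_n` of `a = g ⋉ V`. -/
def gradedWeights (H : LieSubalgebra ℂ g) (n : ℕ) : Set (Module.Dual ℂ H) :=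
  {η | ∃ x ∈ SemidirectLie.grading g V n, x ≠ 0 ∧
    ∀ h : H, ⁅SemidirectLie.inl g V (h : g), x⁆ = η h • x}

variable (V) in
/-- `Covers V p q`, for `p = (λ, r)` and `q = (μ, s)` in `Λ`, says that `q` covers `p`: `s > r` and
`μ - λ ∈ wt(a_{s - r})`. -/
def Covers {b : (LieAlgebra.IsKilling.rootSystem H).Base} (p q : SimpleIndex b) : Prop :=
  p.2 < q.2 ∧ (q.1 : Module.Dual ℂ H) - (p.1 : Module.Dual ℂ H) ∈
    gradedWeights V H (q.2 - p.2).toNat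

variable (V) in
/-- The order `≼` on `Λ`: the reflexive and transitive closure of the covering relation. -/
def Precedes {b : (LieAlgebra.IsKilling.rootSystem H).Base} : SimpleIndex b → SimpleIndex b → Prop :=
  Relation.ReflTransGen (Covers V)

variable (V) in
/-- Interval-closed subsets of `Λ`. -/
def IsIntervalClosed {b : (LieAlgebra.IsKilling.rootSystem H).Base} (Γ : Set (SimpleIndex b)) :
    Prop :=
  ∀ p ∈ Γ, ∀ q ∈ Γ, ∀ t, Precedes V p t → Precedes V t q → t ∈ Γ

/-- `[M : V(λ, r)] > 0` for `p = (λ, r)`, i.e. `Hom_g(V(λ), M[r]) ≠ 0`, where `V(λ)` is the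
finite-dimensional simple `g`-module with highest weight `λ`. -/
def MultPos {b : (LieAlgebra.IsKilling.rootSystem H).Base} (M : GHat.{u, v, w} g V)
    (p : SimpleIndex b) : Prop :=
  ∃ (L : Type w) (_ : AddCommGroup L) (_ : Module ℂ L) (_ : LieRingModule g L)
    (_ : LieModule ℂ g L) (_ : FiniteDimensional ℂ L),
    IsSimpleOfHighestWeight b (p.1 : Module.Dual ℂ H) L ∧ ∃ f : L →ₗ⁅ℂ,g⁆ M.piece p.2, f ≠ 0

variable (V) in
/-- The property of objects `M` of `Ĝ` which defines the full subcategory `G[Γ]`: `M` is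
finite-dimensional, and `[M : V(λ, r)] > 0` only for `(λ, r) ∈ Γ`. -/
def truncated {b : (LieAlgebra.IsKilling.rootSystem H).Base} (Γ : Set (SimpleIndex b)) :
    ObjectProperty (GHat.{u, v, w} g V) :=
  fun M ↦ FiniteDimensional ℂ M ∧ ∀ p : SimpleIndex b, MultPos M p → p ∈ Γ

variable {b : (LieAlgebra.IsKilling.rootSystem H).Base} (Γ : Set (SimpleIndex b))

instance : (truncated.{u, v, w} V Γ).IsClosedUnderSubobjects where
  prop_of_mono {M N} f _ hN := by
    have hf := GrLieMod.injective_of_mono f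
    obtain ⟨hfin, hN⟩ := hN
    refine ⟨FiniteDimensional.of_injective (f.toLie : M →ₗ[ℂ] N) hf, ?_⟩
    rintro p ⟨L, _, _, _, _, _, hL, φ, hφ⟩
    refine hN p ⟨L, _, _, _, _, inferInstance, hL, (GHat.mapPiece f p.2).comp φ, fun h ↦ hφ ?_⟩
    ext m
    apply GHat.mapPiece_injective f hf
    have := LieModuleHom.congr_fun h m
    simpa using this

instance : (truncated.{u, v, w} V Γ).IsClosedUnderQuotients where
  prop_of_epi {M N} f _ hM := by
    have hf := GrLieMod.surjective_of_epi f
    obtain ⟨hfin, hM⟩ := hM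
    refine ⟨Module.Finite.of_surjective (f.toLie : M →ₗ[ℂ] N) hf, ?_⟩
    rintro p ⟨L, _, _, _, _, _, hL, φ, hφ⟩
    obtain ⟨ψ, hψ⟩ := weyl_lift (GHat.mapPiece f p.2) (GHat.mapPiece_surjective f hf p.2) φ
    refine hM p ⟨L, _, _, _, _, inferInstance, hL, ψ, fun h ↦ hφ ?_⟩
    ext m
    rw [← hψ, h]
    simp

instance : (truncated.{u, v, w} V Γ).ContainsZero where
  exists_zero := by
    refine ⟨GrLieMod.zeroMod _, (IsZero.iff_id_eq_zero _).mpr rfl, ?_, ?_⟩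
    · exact inferInstanceAs (FiniteDimensional ℂ PUnit)
    · rintro p ⟨L, _, _, _, _, _, hL, φ, hφ⟩
      have h : ∀ x y : GHat.piece (GrLieMod.zeroMod (SemidirectLie.grading g V)) p.2, x = y :=
        fun x y ↦ Subtype.ext rfl
      exact absurd (LieModuleHom.ext fun m ↦ h _ _) hφ

instance : (truncated.{u, v, w} V Γ).IsClosedUnderExtensions where
  prop_X₂_of_shortExact {S} hS h₁ h₃ := by
    obtain ⟨hfin₁, h₁⟩ := h₁
    obtain ⟨hfin₃, h₃⟩ := h₃
    have hmono := hS.mono_f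
    have hepi := hS.epi_g
    have hf := GrLieMod.injective_of_mono S.f
    have hex : ∀ n, S.g.toLie n = 0 → ∃ m, S.f.toLie m = n := by
      intro n hn
      obtain ⟨x, rfl⟩ := GrLieMod.exists_kerι S.g n hn
      let k := hS.fIsKernel.lift (KernelFork.ofι _ (GrLieMod.kerι_comp S.g))
      have hk : k ≫ S.f = GrLieMod.kerι S.g :=
        hS.fIsKernel.fac (KernelFork.ofι _ (GrLieMod.kerι_comp S.g)) WalkingParallelPair.zero
      exact ⟨k.toLie x, by rw [← GrLieMod.comp_toLie, hk]⟩
    refine ⟨?_, ?_⟩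
    · have h1 : (LinearMap.ker (S.g.toLie : S.X₂ →ₗ[ℂ] S.X₃)).FG := by
        have : LinearMap.ker (S.g.toLie : S.X₂ →ₗ[ℂ] S.X₃) ≤
            LinearMap.range (S.f.toLie : S.X₁ →ₗ[ℂ] S.X₂) := fun n hn ↦ hex n hn
        exact Module.Finite.iff_fg.mp (Submodule.finiteDimensional_of_le this)
      refine ⟨Submodule.fg_of_fg_map_of_fg_inf_ker (S.g.toLie : S.X₂ →ₗ[ℂ] S.X₃) ?_ ?_⟩
      · exact IsNoetherian.noetherian _
      · simpa using h1
    · rintro p ⟨L, _, _, _, _, _, hL, φ, hφ⟩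
      by_cases h : (GHat.mapPiece S.g p.2).comp φ = 0
      · have hlift : ∀ l, ∃ m, GHat.mapPiece S.f p.2 m = φ l := by
          intro l
          have hl := congrArg Subtype.val (LieModuleHom.congr_fun h l)
          obtain ⟨m, hm⟩ := hex (φ l).1 hl
          refine ⟨⟨S.X₁.proj p.2 m, GrLieMod.proj_mem _ _⟩, Subtype.ext ?_⟩
          change S.f.toLie (S.X₁.proj p.2 m) = (φ l).1
          rw [GrLieMod.map_proj, hm, GrLieMod.proj_of_mem _ _ _ (φ l).2, if_pos rfl]
        choose ψ hψ using hlift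
        have hinj := GHat.mapPiece_injective S.f hf p.2
        refine h₁ p ⟨L, _, _, _, _, inferInstance, hL,
          { toFun := ψ
            map_add' := fun x y ↦ hinj (by rw [hψ, map_add, map_add, hψ, hψ])
            map_smul' := fun c x ↦ hinj (by
              rw [hψ, map_smul, RingHom.id_apply, map_smul, hψ])
            map_lie' := fun {x m} ↦ hinj (by
              rw [LieModuleHom.map_lie]
              exact (hψ _).trans ((φ.map_lie x m).trans (by rw [hψ]))) }, fun h0 ↦ hφ ?_⟩
        ext l
        have := LieModuleHom.congr_fun h0 l
        have e : ψ l = 0 := this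
        rw [← hψ, e]
        simp
      · exact h₃ p ⟨L, _, _, _, _, inferInstance, hL, _, h⟩

instance : (truncated.{u, v, w} V Γ).IsSerreClass where

instance : (truncated.{u, v, w} V Γ).IsClosedUnderFiniteProducts := by
  have h2 : (truncated.{u, v, w} V Γ).IsClosedUnderBinaryProducts :=
    { limitsOfShape_le := by
        rintro X ⟨p⟩
        refine (truncated.{u, v, w} V Γ).prop_of_iso ?_ ((truncated.{u, v, w} V Γ).prop_biprod
          (p.prop_diag_obj (.mk .left)) (p.prop_diag_obj (.mk .right)))
        exact IsLimit.conePointUniqueUpToIso (BinaryBiproduct.isLimit _ _)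
          ((IsLimit.postcomposeHomEquiv (diagramIsoPair p.diag) _).2 p.isLimit) }
  have h0 : (truncated.{u, v, w} V Γ).IsClosedUnderLimitsOfShape (Discrete.{0} PEmpty) :=
    { limitsOfShape_le := by
        rintro X ⟨p⟩
        refine (truncated.{u, v, w} V Γ).prop_of_isZero ?_
        rw [IsZero.iff_id_eq_zero]
        exact p.isLimit.hom_ext fun ⟨j⟩ ↦ j.elim }
  exact .mk'

noncomputable instance : Abelian (truncated.{u, v, w} V Γ).FullSubcategory := inferInstance

instance : PreservesFiniteLimits (truncated.{u, v, w} V Γ).ι :=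
  have h := (truncated.{u, v, w} V Γ).preservesKernels_ι
  Functor.preservesFiniteLimits_of_preservesKernels _

instance : PreservesFiniteColimits (truncated.{u, v, w} V Γ).ι :=
  have h := (truncated.{u, v, w} V Γ).preservesCokernels_ι
  Functor.preservesFiniteColimits_of_preservesCokernels _

instance : HasExt.{max u v (w + 1)} (GHat.{u, v, w} g V) := HasExt.standard _

instance : HasExt.{max u v (w + 1)} (truncated.{u, v, w} V Γ).FullSubcategory := HasExt.standard _

variable (V) in
/-- The simple object `V(λ, r)` of `G[Γ]`, for `(λ, r) ∈ Γ` and a model `L` of `V(λ)`. -/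
def simpleObj {p : SimpleIndex b} (hp : p ∈ Γ) (L : Type w) [AddCommGroup L] [Module ℂ L]
    [LieRingModule g L] [LieModule ℂ g L] [FiniteDimensional ℂ L]
    (hL : IsSimpleOfHighestWeight b (p.1 : Module.Dual ℂ H) L) :
    (truncated.{u, v, w} V Γ).FullSubcategory where
  obj := GHat.shiftedEv V L p.2
  property := by
    refine ⟨inferInstanceAs (FiniteDimensional ℂ L), ?_⟩
    rintro q ⟨L', _, _, _, _, _, hL', f, hf⟩
    obtain ⟨l, hl⟩ : ∃ l, f l ≠ 0 := by
      by_contra! h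
      exact hf (LieModuleHom.ext h)
    have hq : q.2 = p.2 := by
      by_contra hne
      have h := (f l).2
      change (f l).1 ∈ (if q.2 = p.2 then (⊤ : Submodule ℂ L) else ⊥) at h
      rw [if_neg hne] at h
      exact hl (Subtype.ext h)
    -- the composite of `f` with the inclusion in `L` is an isomorphism by Schur's lemma
    let F : L' →ₗ⁅ℂ,g⁆ L :=
      { toFun := fun m ↦ (f m).1
        map_add' := fun x y ↦ by rw [map_add]; rfl
        map_smul' := fun c x ↦ by rw [map_smul]; rfl
        map_lie' := fun {x m} ↦ by rw [LieModuleHom.map_lie]; rfl }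
    have hFl : F l ≠ 0 := fun h ↦ hl (Subtype.ext h)
    have hirr' := hL'.1
    have hirr := hL.1
    have hker : F.ker = ⊥ := (IsSimpleOrder.eq_bot_or_eq_top F.ker).resolve_right fun h ↦
      hFl (LieModuleHom.mem_ker.mp (by rw [h]; trivial))
    have hinj : Function.Injective F := (LieModuleHom.ker_eq_bot F).mp hker
    have hrange : F.range = ⊤ := (IsSimpleOrder.eq_bot_or_eq_top F.range).resolve_left fun h ↦ by
      have : F l ∈ F.range := (LieModuleHom.mem_range _ _).mpr ⟨l, rfl⟩
      rw [h] at this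
      exact hFl (by simpa using this)
    obtain ⟨-, v, hv0, hvH, hvn⟩ := id hL'
    have hL'' : IsSimpleOfHighestWeight b (q.1 : Module.Dual ℂ H) L := by
      refine ⟨hirr, F v, fun h ↦ hv0 (hinj (by rw [h, map_zero])), fun h ↦ ?_, fun α hα x hx ↦ ?_⟩
      · rw [← LieModuleHom.map_lie, hvH, map_smul]
      · rw [← LieModuleHom.map_lie, hvn α hα x hx, map_zero]
    have hqp : q = p := Prod.ext (Subtype.ext (isSimpleOfHighestWeight_unique hL'' hL)) hq
    rw [hqp]
    exact hp

end Truncation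

/-! The category `G[Γ]` is reached from all of `Ĝ` by exact functors, and this forces the Ext groups
to agree. Call a subset `S` of `Λ` up-closed if it contains every element that covers one of its
members. In a graded module only `V` changes the degree, carrying `M[r]` to `M[r + 1]`, and a
nonzero `g`-map `V ⊗ V(λ) → V(μ)` exists only if `μ - λ` is a weight of `V`
(`exists_weight_vector_of_bilinear`), that is, only if `(μ, r + 1)` covers `(λ, r)`. So for
up-closed `S` the sum `M_S` of the simple `g`-submodules of type in `S` is stable under `g ⋉ V`. By
Weyl's theorem `M` is the direct sum of `M_S` and the part of complementary type as a `g`-module,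
naturally in `M`; hence `M ↦ M_S` and `M ↦ M / M_S` are exact.

Let `U` be the up-closure of `Γ`. Interval-closedness amounts to `U \ Γ` being up-closed, so `F(M) =
M_U / (M_U)_{U \ Γ}` is an exact functor. Its values lie in `G[Γ]`: the types that occur are in `Γ`,
and a finite `Γ` meets finitely many degrees, each with a finite-dimensional component. The natural
maps `M ← M_U → F(M)` are isomorphisms when `M` lies in `G[Γ]`.

Exact functors act on Ext, and natural transformations between them intertwine the actions
(`mapExactFunctor_naturality`). This is checked on morphisms and on classes of short exact
sequences, which generate Ext under products because Ext is effaceable in positive degrees. With `ι`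
the inclusion, `F ∘ ι ≅ id` makes the action of `ι` injective, and the zigzag `id ← (-)_U → ι ∘ F`
makes it surjective (`mapExactFunctor_bijective_of_zigzag`). No resolutions are needed, and the
argument applies to all objects of `G[Γ]`, simple or not. -/

set_option linter.unusedSectionVars false

/-! ### Effaceability of Ext and the action of exact functors on Ext -/

section ExtOfExactFunctors

universe w₁ w₂ w₃ v₁ v₂ v₃ u₁ u₂ u₃

open HomologicalComplex in
/-- A quasi-isomorphism from a complex in degrees `≤ i` to an object in degree `i` gives an
epimorphism from the degree `i` term. -/
theorem CochainComplex.exists_epi_comp_single {C : Type u₁} [Category.{v₁} C] [Abelian C] {P : C}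
    {K : CochainComplex C ℤ} {i : ℤ} (π : K ⟶ (single C (ComplexShape.up ℤ) i).obj P)
    [K.IsStrictlyLE i] [QuasiIsoAt π i] :
    ∃ (Z : C) (p : Z ⟶ P) (_ : Epi p) (σ : (single C (ComplexShape.up ℤ) i).obj Z ⟶ K),
      σ ≫ π = (single C (ComplexShape.up ℤ) i).map p := by
  -- Since `K` vanishes above degree `i`, everything in degree `i` is a cycle. Thus `α` is an
  -- isomorphism, the projection onto homology and two more isomorphisms, hence an epimorphism.
  let e := K.iCyclesIso i (i + 1) (by simp)
    ((K.isZero_of_isStrictlyLE i (i + 1) (by simp)).eq_of_tgt _ _)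
  let α := e.inv ≫ K.homologyπ i ≫ homologyMap π i ≫ (singleObjHomologySelfIso _ _ _).hom
  have hα : π.f i = α ≫ (singleObjXSelf (ComplexShape.up ℤ) i P).inv := by
    have he : e.hom = K.iCycles i := rfl
    rw [← cancel_epi e.hom]
    simp only [α, Category.assoc, Iso.hom_inv_id_assoc]
    rw [he, homologyπ_naturality_assoc, homologyπ_singleObjHomologySelfIso_hom_assoc,
      ← singleObjCyclesSelfIso_inv_iCycles, Iso.hom_inv_id_assoc, ← cyclesMap_i]
  have : Epi α := inferInstance
  -- The identity of the top term is a chain map from the complex concentrated in degree `i`,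
  -- because the next differential has zero target.
  refine ⟨K.X i, α, inferInstance, mkHomFromSingle (𝟙 _) (by
    rintro _ rfl
    apply (K.isZero_of_isStrictlyLE i (i + 1) (by simp)).eq_of_tgt), ?_⟩
  apply HomologicalComplex.from_single_hom_ext
  rw [comp_f, mkHomFromSingle_f, hα]
  simp [HomologicalComplex.single_map_f_self]

/-- Write `φ` as a right fraction `K ⟶ L` over a quasi-isomorphism from some `K` in degrees at most
`i` to `P`. The top term of `K` covers `P` and maps to `K`; its composite to `L` vanishes, as it
lives in degree `i`, where `L` is zero. This is effaceability of Ext in the language of complexes.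
-/
theorem DerivedCategory.exists_epi_comp_eq_zero {C : Type u₁} [Category.{v₁} C] [Abelian C]
    [HasDerivedCategory.{w₁} C] {P : C} {L : CochainComplex C ℤ} {i : ℤ}
    (φ : Q.obj ((CochainComplex.singleFunctor C i).obj P) ⟶ Q.obj L)
    (n : ℤ) (hn : n < i) [L.IsStrictlyLE n] :
    ∃ (Z : C) (p : Z ⟶ P) (_ : Epi p),
      Q.map ((CochainComplex.singleFunctor C i).map p) ≫ φ = 0 := by
  obtain ⟨K, _, π, h, g, rfl⟩ := right_fac_of_isStrictlyLE φ i
  have hq : QuasiIso π := by rwa [isIso_Q_map_iff_quasiIso] at h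
  obtain ⟨Z, p, hp, σ, hσ⟩ : ∃ (Z : C) (p : Z ⟶ P) (_ : Epi p)
      (σ : (CochainComplex.singleFunctor C i).obj Z ⟶ K),
      σ ≫ π = (CochainComplex.singleFunctor C i).map p :=
    @CochainComplex.exists_epi_comp_single _ _ _ _ _ _ π _ (hq.quasiIsoAt i)
  refine ⟨Z, p, hp, ?_⟩
  have h₂ : σ ≫ g = 0 := by
    apply HomologicalComplex.from_single_hom_ext
    apply (L.isZero_of_isStrictlyLE n i hn).eq_of_tgt
  rw [← hσ, Functor.map_comp, Category.assoc, IsIso.hom_inv_id_assoc, ← Functor.map_comp, h₂,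
    Functor.map_zero]

namespace CategoryTheory.Abelian.Ext

variable {C : Type u₁} [Category.{v₁} C] [Abelian C] [HasExt.{w₁} C]

open _root_.DerivedCategory in
/-- `Ext` in positive degrees is effaceable in the first variable. -/
theorem exists_epi_mk₀_comp_eq_zero {X Y : C} {n : ℕ} (ξ : Ext X Y (n + 1)) :
    ∃ (Z : C) (p : Z ⟶ X) (_ : Epi p), (mk₀ p).comp ξ (zero_add _) = 0 := by
  let := HasDerivedCategory.standard C
  -- The shift isomorphism places `Y` in degree `-(n + 1)`, which lies strictly below the degree `0`
  -- of `X` exactly because the class has positive degree.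
  obtain ⟨Z, p, hp, h⟩ := DerivedCategory.exists_epi_comp_eq_zero
    (L := (CochainComplex.singleFunctor C (-(n + 1))).obj Y) (i := 0) (P := X)
    (ξ.hom ≫ ((singleFunctors C).shiftIso (n + 1) (-(n + 1)) 0 (by lia)).hom.app _)
    (-(n + 1)) (by lia)
  refine ⟨Z, p, hp, ?_⟩
  have h' : ((mk₀ p).comp ξ (zero_add _)).hom ≫ ((singleFunctors C).shiftIso (n + 1) (-(n + 1)) 0
      (by lia)).hom.app Y = 0 := by
    rw [comp_hom, mk₀_hom, ShiftedHom.mk₀_comp, Category.assoc]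
    exact h
  ext
  exact ((cancel_mono _).1 (h'.trans Limits.zero_comp.symm)).trans (zero_hom _ _ _).symm

/-- Induction principle for `Ext`: every class of positive degree is the product of the class of a
short exact sequence and a class of lower degree. -/
theorem induction_extClass {motive : ∀ {X Y : C} {n : ℕ}, Ext.{w₁} X Y n → Prop}
    (mk₀ : ∀ {X Y : C} (f : X ⟶ Y), motive (mk₀ f))
    (comp : ∀ {S : ShortComplex C} {Y : C} {n : ℕ} (hS : S.ShortExact) (ξ : Ext S.X₁ Y n),
      motive ξ → motive (hS.extClass.comp ξ (add_comm 1 n)))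
    {X Y : C} {n : ℕ} (ξ : Ext.{w₁} X Y n) : motive ξ := by
  induction n generalizing X with
  | zero =>
    obtain ⟨f, rfl⟩ := (mk₀_bijective X Y).2 ξ
    exact mk₀ f
  | succ n ih =>
    obtain ⟨Z, p, hp, h⟩ := exists_epi_mk₀_comp_eq_zero ξ
    -- Since `ξ` dies on `Z`, the long exact sequence of `0 → ker p → Z → X → 0` makes it the image
    -- of a class of degree `n` under the connecting map.
    let S := ShortComplex.mk _ _ (kernel.condition p)
    have hS : S.ShortExact := { exact := ShortComplex.exact_kernel p }
    obtain ⟨ξ', rfl⟩ := contravariant_sequence_exact₃ hS Y ξ h (add_comm 1 n)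
    exact comp hS ξ' (ih ξ')

variable {D : Type u₂} [Category.{v₂} D] [Abelian D] [HasExt.{w₂} D]
  {E : Type u₃} [Category.{v₃} E] [Abelian E] [HasExt.{w₃} E]

/-- For a short exact sequence, `τ` is a morphism between its two images, so the case of degree one
is the naturality of the extension class. Products of such classes with lower ones follow by
associativity. -/
theorem mapExactFunctor_naturality {F G : C ⥤ D} [F.Additive] [PreservesFiniteLimits F]
    [PreservesFiniteColimits F] [G.Additive] [PreservesFiniteLimits G] [PreservesFiniteColimits G]
    (τ : F ⟶ G) {X Y : C} {n : ℕ} (ξ : Ext.{w₁} X Y n) :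
    (mk₀ (τ.app X)).comp (ξ.mapExactFunctor G) (zero_add n) =
      (ξ.mapExactFunctor F).comp (mk₀ (τ.app Y)) (add_zero n) := by
  induction ξ using induction_extClass with
  | mk₀ f => simp [mapExactFunctor_mk₀]
  | @comp S Y n hS ξ ih =>
    have h : (hS.extClass.mapExactFunctor F).comp (mk₀ (τ.app S.X₁)) (add_zero 1) =
        (mk₀ (τ.app S.X₃)).comp (hS.extClass.mapExactFunctor G) (zero_add 1) := by
      rw [mapExactFunctor_extClass, mapExactFunctor_extClass]
      exact ShortComplex.ShortExact.extClass_naturality (hS.map_of_exact F) (hS.map_of_exact G)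
        (S.mapNatTrans τ)
    rw [mapExactFunctor_comp, mapExactFunctor_comp, comp_assoc_of_third_deg_zero, ← ih,
      ← comp_assoc_of_second_deg_zero, h, comp_assoc _ _ _ _ _ (by lia)]

theorem mapExactFunctor_id {X Y : C} {n : ℕ} (ξ : Ext.{w₁} X Y n) :
    ξ.mapExactFunctor (𝟭 C) = ξ := by
  induction ξ using induction_extClass with
  | mk₀ f => exact mapExactFunctor_mk₀ _ f
  | comp hS ξ ih =>
    have h : hS.extClass.mapExactFunctor (𝟭 C) = hS.extClass := mapExactFunctor_extClass _ hS
    rw [mapExactFunctor_comp, ih, h]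

theorem mapExactFunctor_comp_functor (F : C ⥤ D) (G : D ⥤ E) [F.Additive]
    [PreservesFiniteLimits F] [PreservesFiniteColimits F] [G.Additive] [PreservesFiniteLimits G]
    [PreservesFiniteColimits G] {X Y : C} {n : ℕ} (ξ : Ext.{w₁} X Y n) :
    (ξ.mapExactFunctor F).mapExactFunctor G = ξ.mapExactFunctor (F ⋙ G) := by
  induction ξ using induction_extClass with
  | mk₀ f => simp [mapExactFunctor_mk₀]
  | comp hS ξ ih =>
    have h : (hS.extClass.mapExactFunctor F).mapExactFunctor G =
        hS.extClass.mapExactFunctor (F ⋙ G) := by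
      rw [mapExactFunctor_extClass, mapExactFunctor_extClass]
      exact mapExactFunctor_extClass G (hS.map_of_exact F)
    rw [mapExactFunctor_comp, mapExactFunctor_comp, mapExactFunctor_comp, ih, h]

/-- A fully faithful exact functor `ι : C ⥤ D` induces bijections on `Ext` if there are exact
functors `R` and `F` with natural transformations `𝟭 D ⟵ R ⟶ F ⋙ ι` which are isomorphisms on the
image of `ι`. -/
theorem mapExactFunctor_bijective_of_zigzag (ι : C ⥤ D) [ι.Full] [ι.Faithful] [ι.Additive]
    [PreservesFiniteLimits ι] [PreservesFiniteColimits ι] (R : D ⥤ D) [R.Additive]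
    [PreservesFiniteLimits R] [PreservesFiniteColimits R] (F : D ⥤ C) [F.Additive]
    [PreservesFiniteLimits F] [PreservesFiniteColimits F] (ε : R ⟶ 𝟭 D) (π : R ⟶ F ⋙ ι)
    (hε : ∀ X : C, IsIso (ε.app (ι.obj X))) (hπ : ∀ X : C, IsIso (π.app (ι.obj X)))
    (X Y : C) (n : ℕ) :
    Function.Bijective fun ξ : Ext.{w₁} X Y n ↦ (ξ.mapExactFunctor ι : Ext.{w₂} _ _ n) := by
  have cancel_left : ∀ {A B : D} (f : A ⟶ B) [IsIso f] {Z : D} {ξ ξ' : Ext.{w₂} B Z n},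
      (mk₀ f).comp ξ (zero_add n) = (mk₀ f).comp ξ' (zero_add n) → ξ = ξ' := by
    intro A B f _ Z ξ ξ' h
    have := congrArg (fun x ↦ (mk₀ (inv f)).comp x (zero_add n)) h
    simpa using this
  have cancel_right : ∀ {A B : D} (f : A ⟶ B) [IsIso f] {Z : D} {ξ ξ' : Ext.{w₂} Z A n},
      ξ.comp (mk₀ f) (add_zero n) = ξ'.comp (mk₀ f) (add_zero n) → ξ = ξ' := by
    intro A B f _ Z ξ ξ' h
    have := congrArg (fun x ↦ x.comp (mk₀ (inv f)) (add_zero n)) h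
    simpa using this
  have hε' : IsIso (Functor.whiskerLeft ι ε) := by
    have : ∀ X, IsIso ((Functor.whiskerLeft ι ε).app X) := hε
    exact NatIso.isIso_of_isIso_app _
  have hπ' : IsIso (Functor.whiskerLeft ι π) := by
    have : ∀ X, IsIso ((Functor.whiskerLeft ι π).app X) := hπ
    exact NatIso.isIso_of_isIso_app _
  -- Over the image of `ι` the zigzag gives `ι ⋙ F ⋙ ι ≅ ι`; postcomposition with the fully faithful
  -- `ι` reflects this to an isomorphism `ι ⋙ F ≅ 𝟭 C`.
  let e : (ι ⋙ F) ≅ 𝟭 C := (Functor.FullyFaithful.ofFullyFaithful ι).whiskeringRight C |>.preimageIso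
    ((asIso (Functor.whiskerLeft ι π)).symm ≪≫ asIso (Functor.whiskerLeft ι ε) ≪≫
      ι.rightUnitor ≪≫ ι.leftUnitor.symm)
  constructor
  -- By naturality along `e`, the class `ξ` is recovered from its image under `ι` followed by `F`.
  · intro ξ ξ' h
    have h1 := congrArg (fun x : Ext.{w₂} _ _ n ↦ (x.mapExactFunctor F : Ext.{w₁} _ _ n)) h
    simp only [mapExactFunctor_comp_functor] at h1
    have h2 := mapExactFunctor_naturality e.hom ξ
    have h3 := mapExactFunctor_naturality e.hom ξ'
    rw [h1, ← h3, mapExactFunctor_id, mapExactFunctor_id] at h2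
    have := congrArg (fun x ↦ (mk₀ (e.inv.app X)).comp x (zero_add n)) h2
    simpa using this
  · intro ξ
    let a : X ⟶ F.obj (ι.obj X) := e.inv.app X
    let b : F.obj (ι.obj Y) ⟶ Y := e.hom.app Y
    -- The preimage is `F(ξ)` conjugated by `e`. Under `ι` the conjugating maps become the zigzag:
    -- naturality of `π` replaces `ιF(ξ)` by `R(ξ)`, and naturality of `ε` replaces `R(ξ)` by `ξ`.
    refine ⟨((mk₀ a).comp (ξ.mapExactFunctor F) (zero_add n)).comp (mk₀ b) (add_zero n), ?_⟩
    have ha : ι.map a = inv (ε.app (ι.obj X)) ≫ π.app (ι.obj X) := by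
      simp [a, e]
    have hb : π.app (ι.obj Y) ≫ ι.map b = ε.app (ι.obj Y) := by
      simp [b, e]
    have h2 := mapExactFunctor_naturality π ξ
    have h3 := mapExactFunctor_naturality ε ξ
    rw [mapExactFunctor_id] at h3
    apply cancel_left (ε.app (ι.obj X))
    rw [h3]
    simp only [mapExactFunctor_comp, mapExactFunctor_mk₀, mapExactFunctor_comp_functor, ha]
    rw [comp_assoc_of_third_deg_zero, mk₀_comp_mk₀_assoc, IsIso.hom_inv_id_assoc,
      ← comp_assoc_of_third_deg_zero, h2, comp_assoc_of_third_deg_zero, mk₀_comp_mk₀, hb]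

end CategoryTheory.Abelian.Ext

end ExtOfExactFunctors

/-! ### Highest weights and isotypic parts of finite-dimensional `g`-modules -/

section WeightPart

variable {g : Type u} [LieRing g] [LieAlgebra ℂ g] [FiniteDimensional ℂ g]
  [LieAlgebra.IsSemisimple ℂ g] {H : LieSubalgebra ℂ g} [H.IsCartanSubalgebra]
  {b : (LieAlgebra.IsKilling.rootSystem H).Base}

/-- The height, as a linear functional on `H^*`. -/
theorem exists_height (b : (LieAlgebra.IsKilling.rootSystem H).Base) :
    ∃ f : Module.Dual ℂ H →ₗ[ℂ] ℂ,
      (∀ β ∈ AddSubmonoid.closure ((LieAlgebra.IsKilling.rootSystem H).root '' b.support),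
        ∃ n : ℕ, f β = n) ∧
      ∀ α : H.root, b.IsPos α → ∃ n : ℕ, f ((LieAlgebra.IsKilling.rootSystem H).root α) = n + 1 := by
  let f : Module.Dual ℂ H →ₗ[ℂ] ℂ := b.toWeightBasis.constr ℂ fun _ ↦ (1 : ℂ)
  have hf : ∀ i ∈ b.support, f ((LieAlgebra.IsKilling.rootSystem H).root i) = 1 := by
    intro i hi
    have := b.toWeightBasis.constr_basis ℂ (fun _ ↦ (1 : ℂ)) ⟨i, hi⟩
    rwa [RootPairing.Base.toWeightBasis_apply] at this
  refine ⟨f, fun β hβ ↦ ?_, fun α hα ↦ ?_⟩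
  · induction hβ using AddSubmonoid.closure_induction with
    | mem x hx =>
      obtain ⟨i, hi, rfl⟩ := hx
      exact ⟨1, by rw [hf i hi, Nat.cast_one]⟩
    | zero => exact ⟨0, by simp⟩
    | add x y _ _ hx hy =>
      obtain ⟨n, hn⟩ := hx
      obtain ⟨m, hm⟩ := hy
      exact ⟨n + m, by simp [hn, hm]⟩
  · refine RootPairing.Base.IsPos.induction_on_add (b := b) hα
      (p := fun α ↦ ∃ n : ℕ, f ((LieAlgebra.IsKilling.rootSystem H).root α) = n + 1) ?_ ?_
    · intro i hi
      exact ⟨0, by rw [hf i hi]; simp⟩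
    · rintro i j k hk ⟨n, hn⟩ hj
      exact ⟨n + 1, by rw [hk, map_add, hn, hf j hj]; push_cast; rfl⟩

variable {W : Type*} [AddCommGroup W] [Module ℂ W] [LieRingModule g W] [LieModule ℂ g W]
  [FiniteDimensional ℂ W]
  {W' : Type*} [AddCommGroup W'] [Module ℂ W'] [LieRingModule g W'] [LieModule ℂ g W']
  [FiniteDimensional ℂ W']

/-- Weight decompositions are available for generalized weight spaces, whereas weights in the sense
of `gradedWeights` need honest eigenvectors. This passes from the former to the latter, and shows
that `χ` is linear. -/
theorem exists_weight_vector {χ : H → ℂ} (hχ : LieModule.genWeightSpace W χ ≠ ⊥) :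
    ∃ lam : Module.Dual ℂ H, (lam : H → ℂ) = χ ∧
      ∃ w : W, w ≠ 0 ∧ ∀ h : H, ⁅(h : g), w⁆ = lam h • w := by
  let χ' : LieModule.Weight ℂ H W := ⟨χ, hχ⟩
  obtain ⟨w, hw0, hw⟩ := LieModule.exists_forall_lie_eq_smul ℂ H W χ'
  exact ⟨LieModule.Weight.toLinear ℂ H W χ', rfl, w, hw0, hw⟩

variable (b W) in
-- Among the finitely many weights one has maximal height. A positive root vector that did not kill
-- its weight vector would produce a weight of larger height. Real parts are compared because the
-- height of a weight is a complex number; positive roots raise it by a positive integer.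
theorem exists_highest_weight_vector [Nontrivial W] :
    ∃ (lam : Module.Dual ℂ H) (v : W), v ≠ 0 ∧ (∀ h : H, ⁅(h : g), v⁆ = lam h • v) ∧
      ∀ α : H.root, b.IsPos α →
        ∀ x ∈ LieAlgebra.rootSpace H (α : LieModule.Weight ℂ H g), ⁅x, v⁆ = 0 := by
  obtain ⟨f, -, hf⟩ := exists_height b
  have hne : Nonempty (LieModule.Weight ℂ H W) := by
    by_contra h
    rw [not_nonempty_iff] at h
    have := LieModule.iSup_genWeightSpace_eq_top' ℂ H W
    rw [iSup_of_empty] at this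
    exact bot_ne_top this
  obtain ⟨χ, hχ⟩ := Finite.exists_max fun χ : LieModule.Weight ℂ H W ↦
    (f (LieModule.Weight.toLinear ℂ H W χ)).re
  obtain ⟨v, hv0, hv⟩ := LieModule.exists_forall_lie_eq_smul ℂ H W χ
  refine ⟨LieModule.Weight.toLinear ℂ H W χ, v, hv0, hv, fun α hα x hx ↦ ?_⟩
  by_contra hne
  have hv1 : v ∈ LieModule.genWeightSpace W (χ : H → ℂ) := by
    apply LieModule.weightSpace_le_genWeightSpace
    rw [LieModule.mem_weightSpace]
    exact hv
  have h := LieAlgebra.lie_mem_genWeightSpace_of_mem_genWeightSpace hx hv1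
  let ψ : LieModule.Weight ℂ H W := ⟨_, fun h0 ↦ hne (by rwa [h0, LieSubmodule.mem_bot] at h)⟩
  obtain ⟨n, hn⟩ := hf α hα
  have e : LieModule.Weight.toLinear ℂ H W ψ =
      (LieAlgebra.IsKilling.rootSystem H).root α + LieModule.Weight.toLinear ℂ H W χ := by
    ext h
    rfl
  have := hχ ψ
  rw [e, map_add, hn] at this
  simp at this
  have h0 : (0 : ℝ) ≤ n := Nat.cast_nonneg n
  linarith

/-- For each simple root, a highest weight vector is primitive for the corresponding `sl₂`-triple,
and finite-dimensionality makes its eigenvalue on the coroot a natural number. -/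
theorem IsSimpleOfHighestWeight.mem_dominantWeights {lam : Module.Dual ℂ H}
    (h : IsSimpleOfHighestWeight b lam W) : lam ∈ dominantWeights b := by
  obtain ⟨-, v, hv0, hvH, hvn⟩ := h
  intro i hi
  have hnz : (i : LieModule.Weight ℂ H g).IsNonZero := by
    exact (Finset.mem_filter.mp i.2).2
  obtain ⟨h, e, f, ht, he, hf⟩ := LieAlgebra.IsKilling.exists_isSl2Triple_of_weight_isNonZero hnz
  have hh := ht.h_eq_coroot hnz he hf
  have P : ht.HasPrimitiveVectorWith v
      (lam (LieAlgebra.IsKilling.coroot (i : LieModule.Weight ℂ H g))) :=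
    { ne_zero := hv0
      lie_h := by rw [hh]; exact hvH _
      lie_e := hvn i (RootPairing.Base.isPos_of_mem_support hi) e he }
  exact P.exists_nat

theorem IsSimpleOfHighestWeight.of_bijective {lam : Module.Dual ℂ H}
    (h : IsSimpleOfHighestWeight b lam W) (φ : W →ₗ⁅ℂ,g⁆ W') (hφ : Function.Bijective φ) :
    IsSimpleOfHighestWeight b lam W' := by
  obtain ⟨hirr, v, hv0, hvH, hvn⟩ := h
  refine ⟨?_, φ v, fun h ↦ hv0 (hφ.1 (by rw [h, map_zero])), fun h ↦ ?_, fun α hα x hx ↦ ?_⟩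
  · have : Nontrivial W' := ⟨φ v, 0, fun h ↦ hv0 (hφ.1 (by rw [h, map_zero]))⟩
    refine LieModule.IsIrreducible.mk fun N hN ↦ ?_
    have h1 : N.comap φ = ⊤ := by
      refine (IsSimpleOrder.eq_bot_or_eq_top _).resolve_left fun h0 ↦ hN ?_
      rw [LieSubmodule.eq_bot_iff] at h0 ⊢
      intro n hn
      obtain ⟨m, rfl⟩ := hφ.2 n
      rw [h0 m hn, map_zero]
    rw [eq_top_iff]
    rintro n -
    obtain ⟨m, rfl⟩ := hφ.2 n
    have : m ∈ N.comap φ := by rw [h1]; trivial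
    exact this
  · rw [← LieModuleHom.map_lie, hvH, map_smul]
  · rw [← LieModuleHom.map_lie, hvn α hα x hx, map_zero]

theorem LieModuleHom.injective_of_isIrreducible [LieModule.IsIrreducible ℂ g W]
    {φ : W →ₗ⁅ℂ,g⁆ W'} (hφ : φ ≠ 0) : Function.Injective φ := by
  have hker : φ.ker = ⊥ := (IsSimpleOrder.eq_bot_or_eq_top φ.ker).resolve_right fun h ↦ hφ (by
    ext m
    exact LieModuleHom.mem_ker.mp (by rw [h]; trivial))
  exact (LieModuleHom.ker_eq_bot φ).mp hker

theorem IsSimpleOfHighestWeight.range {lam : Module.Dual ℂ H}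
    (h : IsSimpleOfHighestWeight b lam W) {φ : W →ₗ⁅ℂ,g⁆ W'} (hφ : φ ≠ 0) :
    IsSimpleOfHighestWeight b lam φ.range := by
  have := h.1
  have hinj := LieModuleHom.injective_of_isIrreducible hφ
  have hmem : ∀ m, φ m ∈ φ.range := fun m ↦ (LieModuleHom.mem_range _ _).mpr ⟨m, rfl⟩
  refine h.of_bijective (φ.codRestrict φ.range hmem) ⟨fun x y hxy ↦ hinj ?_, ?_⟩
  · exact congrArg Subtype.val hxy
  · rintro ⟨n, hn⟩
    obtain ⟨m, rfl⟩ := (LieModuleHom.mem_range _ _).mp hn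
    exact ⟨m, rfl⟩

/-- Schur's lemma. -/
theorem IsSimpleOfHighestWeight.eq_of_ne_zero {lam mu : Module.Dual ℂ H}
    (h : IsSimpleOfHighestWeight b lam W) (h' : IsSimpleOfHighestWeight b mu W')
    {φ : W →ₗ⁅ℂ,g⁆ W'} (hφ : φ ≠ 0) : lam = mu := by
  have := h.1
  have := h'.1
  have hinj := LieModuleHom.injective_of_isIrreducible hφ
  have hrange : φ.range = ⊤ := (IsSimpleOrder.eq_bot_or_eq_top φ.range).resolve_left fun h ↦ hφ (by
    ext m
    have : φ m ∈ φ.range := (LieModuleHom.mem_range _ _).mpr ⟨m, rfl⟩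
    rw [h] at this
    simpa using this)
  have hsurj : Function.Surjective φ := fun n ↦
    (LieModuleHom.mem_range _ _).mp (by rw [hrange]; trivial)
  exact isSimpleOfHighestWeight_unique (h.of_bijective φ ⟨hinj, hsurj⟩) h'

/-- In finite dimension a nonzero submodule contains an atom of the lattice of submodules, which is
irreducible and has a highest weight vector. This is how types are detected throughout: a nonzero
submodule always exhibits one. -/
theorem exists_isSimpleOfHighestWeight_le (b : (LieAlgebra.IsKilling.rootSystem H).Base)
    {N : LieSubmodule ℂ g W} (hN : N ≠ ⊥) :
    ∃ N' ≤ N, ∃ lam, IsSimpleOfHighestWeight b lam N' := by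
  obtain ⟨N', hN', hle⟩ := (eq_bot_or_exists_atom_le N).resolve_left hN
  have : Nontrivial N' := (LieSubmodule.nontrivial_iff_ne_bot _ _ _).mpr hN'.1
  have hirr : LieModule.IsIrreducible ℂ g N' := by
    refine LieModule.IsIrreducible.mk fun K hK ↦ ?_
    have h1 : K.map N'.incl ≤ N' := by
      rintro _ ⟨k, -, rfl⟩
      exact k.2
    rcases hN'.le_iff.mp h1 with h2 | h2
    · refine absurd ?_ hK
      rw [LieSubmodule.eq_bot_iff] at h2 ⊢
      intro k hk
      exact Subtype.ext (h2 k ⟨k, hk, rfl⟩)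
    · rw [eq_top_iff]
      rintro ⟨n, hn⟩ -
      rw [← h2] at hn
      obtain ⟨k, hk, e⟩ := hn
      have : k = ⟨n, by rw [← e]; exact k.2⟩ := Subtype.ext e
      rw [← this]
      exact hk
  obtain ⟨lam, v, hv⟩ := exists_highest_weight_vector b N'
  exact ⟨N', hle, lam, hirr, v, hv⟩

/-- Complete reducibility: there are equivariant projections to submodules. -/
theorem exists_projection (N : LieSubmodule ℂ g W) :
    ∃ p : W →ₗ⁅ℂ,g⁆ N, ∀ n : N, p n = n := by
  -- Weyl's theorem gives an equivariant section `s` of the quotient map; subtracting from the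
  -- identity the composite of the quotient map with `s` gives a projection onto `N`.
  obtain ⟨s, hs⟩ := weyl_lift (LieSubmodule.Quotient.mk' N)
    (LieSubmodule.Quotient.surjective_mk' N) (LieModuleHom.id : (W ⧸ N) →ₗ⁅ℂ,g⁆ (W ⧸ N))
  refine ⟨LieModuleHom.codRestrict N
    (LieModuleHom.id - s.comp (LieSubmodule.Quotient.mk' N)) fun m ↦ ?_, fun n ↦ ?_⟩
  · rw [← LieSubmodule.Quotient.mk_eq_zero']
    change LieSubmodule.Quotient.mk' N (m - s (LieSubmodule.Quotient.mk' N m)) = 0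
    rw [map_sub, hs]
    simp
  · apply Subtype.ext
    have : LieSubmodule.Quotient.mk' N (n : W) = 0 := LieSubmodule.Quotient.mk_eq_zero'.mpr n.2
    change (n : W) - s (LieSubmodule.Quotient.mk' N (n : W)) = n
    rw [this, map_zero, sub_zero]

variable (b W) in
/-- The sum of the simple submodules of `W` with highest weights in `S`. -/
def weightPart (S : Set (Module.Dual ℂ H)) : LieSubmodule ℂ g W :=
  sSup {N | ∃ lam ∈ S, IsSimpleOfHighestWeight b lam N}

theorem le_weightPart {S : Set (Module.Dual ℂ H)} {N : LieSubmodule ℂ g W} {lam : Module.Dual ℂ H}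
    (hlam : lam ∈ S) (hN : IsSimpleOfHighestWeight b lam N) : N ≤ weightPart b W S :=
  le_sSup ⟨lam, hlam, hN⟩

/-- An equivariant projection onto `N` kills, by Schur's lemma, every simple submodule whose highest
weight differs from `lam`. If `lam` were not in `S`, it would kill the whole part of type `S`, and
with it `N`. -/
theorem mem_of_le_weightPart {S : Set (Module.Dual ℂ H)} {N : LieSubmodule ℂ g W}
    {lam : Module.Dual ℂ H} (hN : IsSimpleOfHighestWeight b lam N) (hle : N ≤ weightPart b W S) :
    lam ∈ S := by
  by_contra hlam
  obtain ⟨p, hp⟩ := exists_projection N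
  have h1 : weightPart b W S ≤ p.ker := by
    refine sSup_le ?_
    rintro N' ⟨mu, hmu, hN'⟩ n hn
    by_contra h0
    have hne : p.comp N'.incl ≠ 0 := fun h ↦ h0 (LieModuleHom.congr_fun h ⟨n, hn⟩)
    exact hlam (hN'.eq_of_ne_zero hN hne ▸ hmu)
  obtain ⟨-, v, hv0, -⟩ := hN
  have : (v : W) ∈ p.ker := h1 (hle v.2)
  rw [LieModuleHom.mem_ker, hp] at this
  exact hv0 this

/-- The image of a simple module is zero or simple with the same highest weight. This makes the
isotypic parts functorial. -/
theorem map_mem_weightPart {S : Set (Module.Dual ℂ H)} (φ : W →ₗ⁅ℂ,g⁆ W') {w : W}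
    (hw : w ∈ weightPart b W S) : φ w ∈ weightPart b W' S := by
  have h : weightPart b W S ≤ (weightPart b W' S).comap φ := by
    refine sSup_le ?_
    rintro N ⟨lam, hlam, hN⟩ n hn
    change φ n ∈ weightPart b W' S
    by_cases h0 : φ.comp N.incl = 0
    · have : φ n = 0 := LieModuleHom.congr_fun h0 ⟨n, hn⟩
      rw [this]
      exact zero_mem _
    · exact le_weightPart hlam (hN.range h0) ((LieModuleHom.mem_range _ _).mpr ⟨⟨n, hn⟩, rfl⟩)
  exact h hw

/-- A nonzero intersection would contain a simple submodule, whose highest weight would lie in both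
`S` and `T`. -/
theorem eq_zero_of_mem_weightPart {S T : Set (Module.Dual ℂ H)} (hST : Disjoint S T) {w : W}
    (hS : w ∈ weightPart b W S) (hT : w ∈ weightPart b W T) : w = 0 := by
  by_contra hw
  have hne : weightPart b W S ⊓ weightPart b W T ≠ ⊥ := fun h ↦ hw (by
    have : w ∈ weightPart b W S ⊓ weightPart b W T := ⟨hS, hT⟩
    rwa [h, LieSubmodule.mem_bot] at this)
  obtain ⟨N, hN, lam, hlam⟩ := exists_isSimpleOfHighestWeight_le b hne
  exact Set.disjoint_left.mp hST (mem_of_le_weightPart hlam (hN.trans inf_le_left))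
    (mem_of_le_weightPart hlam (hN.trans inf_le_right))

/-- A simple submodule in the kernel of a projection onto the sum `K` of the two parts would itself
lie in `K`, since its highest weight is dominant; but the projection fixes `K`. -/
theorem exists_add_of_weightPart {S T : Set (Module.Dual ℂ H)}
    (hST : ∀ lam ∈ dominantWeights b, lam ∈ S ∨ lam ∈ T) (w : W) :
    ∃ x ∈ weightPart b W S, ∃ y ∈ weightPart b W T, x + y = w := by
  rw [← LieSubmodule.mem_sup]
  set K := weightPart b W S ⊔ weightPart b W T
  obtain ⟨p, hp⟩ := exists_projection K
  have hker : p.ker = ⊥ := by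
    by_contra hne
    obtain ⟨N, hN, lam, hlam⟩ := exists_isSimpleOfHighestWeight_le b hne
    have hNK : N ≤ K := by
      rcases hST lam hlam.mem_dominantWeights with h | h
      · exact (le_weightPart h hlam).trans le_sup_left
      · exact (le_weightPart h hlam).trans le_sup_right
    obtain ⟨-, v, hv0, -⟩ := hlam
    have h1 : p v = 0 := LieModuleHom.mem_ker.mp (hN v.2)
    have h2 := hp ⟨v, hNK v.2⟩
    rw [h1] at h2
    exact hv0 (Subtype.ext (congrArg Subtype.val h2).symm)
  have hinj := (LieModuleHom.ker_eq_bot p).mp hker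
  -- `p` is idempotent and injective, hence the identity.
  have : (p w : W) = w := hinj (hp (p w))
  rw [← this]
  exact (p w).2

end WeightPart

/-! ### Weights of `V` and the constituents of `V ⊗ N` -/

section TensorProduct

variable {g : Type u} [LieRing g] [LieAlgebra ℂ g] [FiniteDimensional ℂ g]
  [LieAlgebra.IsSemisimple ℂ g] {H : LieSubalgebra ℂ g} [H.IsCartanSubalgebra]
  {b : (LieAlgebra.IsKilling.rootSystem H).Base}

/-- A highest weight vector of a simple module generates it under the negative root vectors. -/
theorem eq_top_of_highest_weight_vector_mem {L : Type*} [AddCommGroup L] [Module ℂ L]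
    [LieRingModule g L] [LieModule ℂ g L] [LieModule.IsIrreducible ℂ g L]
    {lam : Module.Dual ℂ H} {v : L} (hv0 : v ≠ 0) (hvH : ∀ h : H, ⁅(h : g), v⁆ = lam h • v)
    (hvn : ∀ α : H.root, b.IsPos α →
      ∀ x ∈ LieAlgebra.rootSpace H (α : LieModule.Weight ℂ H g), ⁅x, v⁆ = 0)
    (S : Submodule ℂ L) (hvS : v ∈ S)
    (hneg : ∀ α : H.root, ¬ b.IsPos α →
      ∀ x ∈ LieAlgebra.rootSpace H (α : LieModule.Weight ℂ H g), ∀ m ∈ S, ⁅x, m⁆ ∈ S) :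
    S = ⊤ := by
  let T : Submodule ℂ L := sInf {S | v ∈ S ∧ ∀ α : H.root, ¬ b.IsPos α →
    ∀ x ∈ LieAlgebra.rootSpace H (α : LieModule.Weight ℂ H g), ∀ m ∈ S, ⁅x, m⁆ ∈ S}
  have hTS : T ≤ S := sInf_le ⟨hvS, hneg⟩
  have hvT : v ∈ T := Submodule.mem_sInf.mpr fun S hS ↦ hS.1
  have hnegT : ∀ α : H.root, ¬ b.IsPos α →
      ∀ x ∈ LieAlgebra.rootSpace H (α : LieModule.Weight ℂ H g), ∀ m ∈ T, ⁅x, m⁆ ∈ T :=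
    fun α hα x hx m hm ↦ Submodule.mem_sInf.mpr fun S' hS' ↦
      hS'.2 α hα x hx m (Submodule.mem_sInf.mp hm S' hS')
  have hvg : ∀ x : g, ⁅x, v⁆ ∈ T := by
    intro x
    have hx : x ∈ (⨆ χ : LieModule.Weight ℂ H g, LieModule.genWeightSpace g χ :
        LieSubmodule ℂ H g) := by
      rw [LieModule.iSup_genWeightSpace_eq_top' ℂ H g]; trivial
    induction hx using LieSubmodule.iSup_induction' with
    | mem χ x hx =>
      by_cases hχ : χ.IsZero
      · have h0 : x ∈ H := by
          have : x ∈ LieAlgebra.rootSpace H (0 : H → ℂ) := by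
            have e : (χ : H → ℂ) = 0 := hχ
            rw [← e]; exact hx
          rw [LieAlgebra.rootSpace_zero_eq] at this
          exact this
        rw [hvH ⟨x, h0⟩]
        exact T.smul_mem _ hvT
      · have hmem : χ ∈ H.root := by simpa using hχ
        by_cases hp : b.IsPos ⟨χ, hmem⟩
        · rw [hvn ⟨χ, hmem⟩ hp x hx]; exact zero_mem _
        · exact hnegT ⟨χ, hmem⟩ hp x hx v hvT
    | zero => simp
    | add x y _ _ hx hy => rw [add_lie]; exact add_mem hx hy
  have hTg : ∀ (x : g) (m : L), m ∈ T → ⁅x, m⁆ ∈ T := by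
    let T' : Submodule ℂ L :=
      { carrier := {m | m ∈ T ∧ ∀ x : g, ⁅x, m⁆ ∈ T}
        add_mem' := fun hx hy ↦ ⟨add_mem hx.1 hy.1, fun x ↦ by
          rw [lie_add]; exact add_mem (hx.2 x) (hy.2 x)⟩
        zero_mem' := ⟨zero_mem _, fun x ↦ by simp⟩
        smul_mem' := fun c x hx ↦ ⟨T.smul_mem c hx.1, fun y ↦ by
          rw [lie_smul]; exact T.smul_mem c (hx.2 y)⟩ }
    have hle : T ≤ T' := sInf_le ⟨⟨hvT, hvg⟩, fun α hα x hx m hm ↦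
      ⟨hnegT α hα x hx m hm.1, fun z ↦ by
        rw [leibniz_lie]
        exact add_mem (hm.2 _) (hnegT α hα x hx _ (hm.2 z))⟩⟩
    exact fun x m hm ↦ (hle hm).2 x
  let T' : LieSubmodule ℂ g L := { T with lie_mem := fun {x m} hm ↦ hTg x m hm }
  have : T' = ⊤ := by
    refine (IsSimpleOrder.eq_bot_or_eq_top T').resolve_left fun h ↦ hv0 ?_
    have : v ∈ T' := hvT
    rwa [h, LieSubmodule.mem_bot] at this
  have hTtop : T = ⊤ := congrArg LieSubmodule.toSubmodule this
  exact eq_top_iff.mpr (hTtop ▸ hTS)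

variable {V : Type*} [AddCommGroup V] [Module ℂ V] [LieRingModule g V] [LieModule ℂ g V]
  [FiniteDimensional ℂ V]
  {N : Type*} [AddCommGroup N] [Module ℂ N] [LieRingModule g N] [LieModule ℂ g N]
  [FiniteDimensional ℂ N]
  {L : Type*} [AddCommGroup L] [Module ℂ L] [LieRingModule g L] [LieModule ℂ g L]
  [FiniteDimensional ℂ L]

theorem mem_genWeightSpace_of_weight_vector {lam : Module.Dual ℂ H} {w : L}
    (hw : ∀ h : H, ⁅(h : g), w⁆ = lam h • w) : w ∈ LieModule.genWeightSpace L (lam : H → ℂ) := by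
  apply LieModule.weightSpace_le_genWeightSpace
  rw [LieModule.mem_weightSpace]
  exact hw

/-- If the simple module with highest weight `mu` is a quotient of `V ⊗ N`, where `N` is simple
with highest weight `lam`, then `mu - lam` is a weight of `V`. -/
theorem exists_weight_vector_of_bilinear (β : V →ₗ[ℂ] N →ₗ[ℂ] L)
    (hβ : ∀ (x : g) (v : V) (n : N), ⁅x, β v n⁆ = β ⁅x, v⁆ n + β v ⁅x, n⁆) (hβ0 : β ≠ 0)
    {lam mu : Module.Dual ℂ H} (hN : IsSimpleOfHighestWeight b lam N)
    (hL : IsSimpleOfHighestWeight b mu L) :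
    ∃ v : V, v ≠ 0 ∧ ∀ h : H, ⁅(h : g), v⁆ = (mu - lam) h • v := by
  have := hN.1
  have := hL.1
  obtain ⟨-, n₀, hn0, hnH, hnn⟩ := hN
  obtain ⟨-, m₀, hm0, hmH, -⟩ := id hL
  obtain ⟨f, hf, hf'⟩ := exists_height b
  -- `K` is a complement of the highest weight space of `L`; lying outside `K` means having a
  -- component of weight `mu`.
  let K : LieSubmodule ℂ H L := ⨆ (χ : H → ℂ) (_ : χ ≠ mu), LieModule.genWeightSpace L χ
  have hK : ∀ χ : H → ℂ, χ ≠ mu → LieModule.genWeightSpace L χ ≤ K :=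
    fun χ hχ ↦ le_iSup₂_of_le χ hχ le_rfl
  have hm0K : m₀ ∉ K := by
    intro h
    have hind := LieModule.iSupIndep_genWeightSpace ℂ H L (mu : H → ℂ)
    have := (disjoint_iff_inf_le.mp hind) ((LieSubmodule.mem_inf _ _ _).mpr
      ⟨mem_genWeightSpace_of_weight_vector hmH, h⟩)
    exact hm0 (by simpa using this)
  have hneg : ∀ α : H.root, ¬ b.IsPos α →
      ∀ x ∈ LieAlgebra.rootSpace H (α : LieModule.Weight ℂ H g), ∀ m : L, ⁅x, m⁆ ∈ K := by
    intro α hα x hx m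
    have hm : m ∈ (⨆ χ : LieModule.Weight ℂ H L, LieModule.genWeightSpace L χ :
        LieSubmodule ℂ H L) := by
      rw [LieModule.iSup_genWeightSpace_eq_top' ℂ H L]; trivial
    induction hm using LieSubmodule.iSup_induction' with
    | mem χ m hm =>
      refine hK _ ?_ (LieAlgebra.lie_mem_genWeightSpace_of_mem_genWeightSpace hx hm)
      intro e
      obtain ⟨nu, hnu, w, hw0, hw⟩ := exists_weight_vector χ.genWeightSpace_ne_bot
      obtain ⟨γ, hγ, e'⟩ := isSimpleOfHighestWeight_sub_mem hL w hw0 hw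
      obtain ⟨k, hk⟩ := hf γ hγ
      -- If a negative root vector reached weight `mu`, the root `α` would equal `γ`, a sum of
      -- simple roots; but `α` has negative height and `γ` has height at least zero.
      obtain ⟨l, hl⟩ := hf' ((LieAlgebra.IsKilling.rootSystem H).indexNeg.neg α)
        (((RootPairing.Base.IsPos.neg_iff_not b α)).mpr hα)
      have e1 : (LieAlgebra.IsKilling.rootSystem H).root α + nu = mu := by
        ext h
        have h1 := congrFun e h
        rw [← hnu] at h1
        exact h1
      rw [RootPairing.indexNeg_neg, RootPairing.root_reflectionPerm,
        RootPairing.reflection_apply_self, map_neg] at hl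
      have e2 : (LieAlgebra.IsKilling.rootSystem H).root α = γ := by
        have := e1.trans e'.symm
        rw [add_comm] at this
        exact add_left_cancel this
      rw [e2, hk] at hl
      have h0 : ((k + l + 1 : ℕ) : ℂ) = 0 := by
        push_cast
        linear_combination -hl
      exact Nat.succ_ne_zero _ (Nat.cast_eq_zero.mp h0)
    | zero => simp
    | add x y _ _ hx hy => rw [lie_add]; exact add_mem hx hy
  -- Otherwise the vectors `n` with `β(V, n)` inside `K` include `n₀` and are stable under negative
  -- root vectors, so they fill `N`. The image of `β` spans a nonzero submodule, which is all of
  -- `L`, and `L` is not contained in `K`.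
  have hgen : ∃ v, β v n₀ ∉ K := by
    by_contra! hcon
    let T : Submodule ℂ N :=
      { carrier := {n | ∀ v, β v n ∈ K}
        add_mem' := fun hx hy v ↦ by rw [map_add]; exact add_mem (hx v) (hy v)
        zero_mem' := fun v ↦ by rw [map_zero]; exact zero_mem _
        smul_mem' := fun c x hx v ↦ by rw [map_smul]; exact K.smul_mem c (hx v) }
    have hT : T = ⊤ := by
      refine eq_top_of_highest_weight_vector_mem hn0 hnH hnn T hcon fun α hα x hx n hn v ↦ ?_
      have : β v ⁅x, n⁆ = ⁅x, β v n⁆ - β ⁅x, v⁆ n := by rw [hβ]; abel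
      rw [this]
      exact sub_mem (hneg α hα x hx _) (hn _)
    let R : LieSubmodule ℂ g L :=
      { Submodule.span ℂ {m | ∃ v n, β v n = m} with
        lie_mem := by
          intro x m hm
          change m ∈ Submodule.span ℂ {m | ∃ v n, β v n = m} at hm
          change ⁅x, m⁆ ∈ Submodule.span ℂ {m | ∃ v n, β v n = m}
          induction hm using Submodule.span_induction with
          | mem m hm =>
            obtain ⟨v, n, rfl⟩ := hm
            rw [hβ]
            exact add_mem (Submodule.subset_span ⟨_, _, rfl⟩) (Submodule.subset_span ⟨_, _, rfl⟩)
          | zero => simp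
          | add y z _ _ hy hz => rw [lie_add]; exact add_mem hy hz
          | smul c y _ hy => rw [lie_smul]; exact Submodule.smul_mem _ c hy }
    have hR : R = ⊤ := by
      refine (IsSimpleOrder.eq_bot_or_eq_top R).resolve_left fun h ↦ hβ0 ?_
      ext v n
      have : β v n ∈ R := Submodule.subset_span ⟨v, n, rfl⟩
      rw [h, LieSubmodule.mem_bot] at this
      simpa using this
    have hRK : R.toSubmodule ≤ K.toSubmodule := by
      refine Submodule.span_le.mpr ?_
      rintro _ ⟨v, n, rfl⟩
      have : n ∈ T := by rw [hT]; trivial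
      exact this v
    refine hm0K (hRK ?_)
    rw [hR]
    trivial
  obtain ⟨v, hv⟩ := hgen
  -- Pairing with `n₀` shifts weights by `lam`. If `mu - lam` were not a weight of `V`, every weight
  -- component of `v` would be sent into `K`.
  have hne : LieModule.genWeightSpace V ((mu - lam : Module.Dual ℂ H) : H → ℂ) ≠ ⊥ := by
    intro hbot
    apply hv
    have hv' : v ∈ (⨆ χ : LieModule.Weight ℂ H V, LieModule.genWeightSpace V χ :
        LieSubmodule ℂ H V) := by
      rw [LieModule.iSup_genWeightSpace_eq_top' ℂ H V]; trivial
    clear hv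
    induction hv' using LieSubmodule.iSup_induction' with
    | mem χ v hv =>
      refine hK (χ + lam) ?_ ?_
      · intro e
        have hχ := χ.genWeightSpace_ne_bot
        refine hχ ?_
        convert hbot using 2
        ext h
        have := congrFun e h
        simp only [Pi.add_apply] at this
        simp [← this]
      · rw [LieModule.mem_genWeightSpace] at hv ⊢
        intro x
        obtain ⟨k, hk⟩ := hv x
        -- Since `n₀` is a true eigenvector, all of the nilpotent part falls on `v`, so the same
        -- power annihilates both sides.
        have key : ∀ (k : ℕ) (v : V),
            ((LieModule.toEnd ℂ H L x - (χ + lam : H → ℂ) x • (1 : Module.End ℂ L)) ^ k) (β v n₀) =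
              β (((LieModule.toEnd ℂ H V x - χ x • (1 : Module.End ℂ V)) ^ k) v) n₀ := by
          intro k
          induction k with
          | zero => intro v; simp
          | succ k ih =>
            intro v
            rw [pow_succ, pow_succ, Module.End.mul_apply, Module.End.mul_apply, ← ih]
            congr 1
            have h1 : ⁅x, β v n₀⁆ = β ⁅x, v⁆ n₀ + β v ⁅(x : g), n₀⁆ := hβ x v n₀
            simp only [LinearMap.sub_apply, LinearMap.add_apply, LieModule.toEnd_apply_apply, LinearMap.smul_apply,
              Module.End.one_apply, h1, hnH, map_smul, map_sub, Pi.add_apply, add_smul]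
            abel
        exact ⟨k, by rw [key, hk]; simp⟩
    | zero => simp
    | add x y _ _ hx hy => rw [map_add, LinearMap.add_apply]; exact add_mem hx hy
  obtain ⟨nu, hnu, w, hw0, hw⟩ := exists_weight_vector hne
  refine ⟨w, hw0, fun h ↦ ?_⟩
  rw [hw h, hnu]

variable {W : Type*} [AddCommGroup W] [Module ℂ W] [LieRingModule g W] [LieModule ℂ g W]
  [FiniteDimensional ℂ W]

/-- A component of `β v n` outside type `S` would yield a simple quotient of `V ⊗ N` whose highest
weight `mu` is not in `S`. Then `mu - lam` would be a weight of `V`, which by assumption puts `mu`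
in `S`. -/
theorem bilinear_mem_weightPart (β : V →ₗ[ℂ] N →ₗ[ℂ] W)
    (hβ : ∀ (x : g) (v : V) (n : N), ⁅x, β v n⁆ = β ⁅x, v⁆ n + β v ⁅x, n⁆)
    {lam : Module.Dual ℂ H} (hN : IsSimpleOfHighestWeight b lam N) {S : Set (Module.Dual ℂ H)}
    (hS : ∀ mu ∈ dominantWeights b, ∀ v : V, v ≠ 0 →
      (∀ h : H, ⁅(h : g), v⁆ = (mu - lam) h • v) → mu ∈ S) (v : V) (n : N) :
    β v n ∈ weightPart b W S := by
  obtain ⟨x, hx, y, hy, hxy⟩ := exists_add_of_weightPart (b := b) (S := S) (T := Sᶜ)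
    (fun lam _ ↦ em _) (β v n)
  suffices y = 0 by rwa [← hxy, this, add_zero]
  by_contra hy0
  obtain ⟨p, hp⟩ := exists_projection (weightPart b W Sᶜ)
  have hpx : p x = 0 := by
    have h1 := map_mem_weightPart ((weightPart b W Sᶜ).incl.comp p) hx
    exact Subtype.ext (eq_zero_of_mem_weightPart disjoint_compl_right h1 (p x).2)
  have hpv : (p (β v n) : W) = y := by
    rw [← hxy, map_add, hpx, zero_add]
    exact congrArg Subtype.val (hp ⟨y, hy⟩)
  -- Choosing the simple submodule inside the submodule generated by `y` guarantees that a
  -- projection onto it does not kill `y`, so that its composite with `β` is nonzero.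
  have hne : LieSubmodule.lieSpan ℂ g {y} ≠ ⊥ := fun h ↦ hy0 (by
    have : y ∈ LieSubmodule.lieSpan ℂ g {y} := LieSubmodule.subset_lieSpan rfl
    rwa [h, LieSubmodule.mem_bot] at this)
  obtain ⟨N', hN', mu, hmu⟩ := exists_isSimpleOfHighestWeight_le b hne
  have hle : LieSubmodule.lieSpan ℂ g {y} ≤ weightPart b W Sᶜ :=
    LieSubmodule.lieSpan_le.mpr (by simpa using hy)
  have hmuS : mu ∉ S := mem_of_le_weightPart hmu (hN'.trans hle)
  obtain ⟨q, hq⟩ := exists_projection N'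
  have hqy : q y ≠ 0 := by
    intro h0
    have h1 : LieSubmodule.lieSpan ℂ g {y} ≤ q.ker :=
      LieSubmodule.lieSpan_le.mpr (by simpa using h0)
    obtain ⟨-, m, hm0, -⟩ := hmu
    have := LieModuleHom.mem_ker.mp (h1 (hN' m.2))
    rw [hq] at this
    exact hm0 this
  let φ : W →ₗ⁅ℂ,g⁆ N' := q.comp ((weightPart b W Sᶜ).incl.comp p)
  obtain ⟨w, hw0, hw⟩ := exists_weight_vector_of_bilinear (β.compr₂ (φ : W →ₗ[ℂ] N'))
    (fun x v n ↦ by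
      change ⁅x, φ (β v n)⁆ = φ (β ⁅x, v⁆ n) + φ (β v ⁅x, n⁆)
      rw [← LieModuleHom.map_lie, hβ, map_add])
    (fun h0 ↦ hqy (by
      have h1 : φ (β v n) = 0 := LinearMap.congr_fun (LinearMap.congr_fun h0 v) n
      rw [← hpv]
      exact h1)) hN hmu
  exact hmuS (hS mu hmu.mem_dominantWeights w hw0 hw)

/-- By equivariance the vectors `m` that are good for all `v` form a `g`-submodule, so it suffices
to treat the simple submodules that generate the part of type `S`. -/
theorem bilinear_mem_weightPart_of_mem (β : V →ₗ[ℂ] L →ₗ[ℂ] W)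
    (hβ : ∀ (x : g) (v : V) (m : L), ⁅x, β v m⁆ = β ⁅x, v⁆ m + β v ⁅x, m⁆)
    {S T : Set (Module.Dual ℂ H)} (hST : ∀ lam ∈ S, ∀ mu ∈ dominantWeights b, ∀ v : V, v ≠ 0 →
      (∀ h : H, ⁅(h : g), v⁆ = (mu - lam) h • v) → mu ∈ T) (v : V) {m : L}
    (hm : m ∈ weightPart b L S) : β v m ∈ weightPart b W T := by
  let K : LieSubmodule ℂ g L :=
    { carrier := {m | ∀ v, β v m ∈ weightPart b W T}
      add_mem' := fun hx hy v ↦ by rw [map_add]; exact add_mem (hx v) (hy v)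
      zero_mem' := fun v ↦ by rw [map_zero]; exact zero_mem _
      smul_mem' := fun c x hx v ↦ by rw [map_smul]; exact SMulMemClass.smul_mem c (hx v)
      lie_mem := fun {x m} hm v ↦ by
        have : β v ⁅x, m⁆ = ⁅x, β v m⁆ - β ⁅x, v⁆ m := by rw [hβ]; abel
        rw [this]
        exact sub_mem (LieSubmodule.lie_mem _ (hm v)) (hm _) }
  suffices weightPart b L S ≤ K from this hm v
  refine sSup_le ?_
  rintro N ⟨lam, hlam, hN⟩ n hn v
  exact bilinear_mem_weightPart (β.compl₂ (N.incl : N →ₗ[ℂ] L)) (fun x v n ↦ hβ x v n.1) hN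
    (hST lam hlam) v ⟨n, hn⟩

end TensorProduct

/-! ### Exactness of graded modules checked on elements -/

namespace GrLieMod

variable {a : Type u} [LieRing a] [LieAlgebra ℂ a] {𝒶 : ℕ → Submodule ℂ a}
  {M N K : GrLieMod.{u, w} 𝒶}

theorem proj_lie {n : ℕ} {x : a} (hx : x ∈ 𝒶 n) (r : ℤ) (m : M) :
    M.proj (r + n) ⁅x, m⁆ = ⁅x, M.proj r m⁆ := by
  have htop := M.isInternal.submodule_iSup_eq_top
  have hm : m ∈ ⨆ r, M.grade r := by rw [htop]; trivial
  induction hm using Submodule.iSup_induction' with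
  | mem s m hm =>
    rw [proj_of_mem _ _ _ (M.lie_mem n s x m hx hm), proj_of_mem r s m hm]
    by_cases h : r = s
    · rw [if_pos (by rw [h]), if_pos h]
    · rw [if_neg (by omega), if_neg h, lie_zero]
  | zero => simp
  | add x y _ _ hx hy => rw [lie_add, map_add, map_add, lie_add, hx, hy]

theorem eq_zero_of_proj {m : M} (h : ∀ r, M.proj r m = 0) : m = 0 := by
  obtain ⟨s, hs⟩ := exists_eq_sum_proj m
  rw [hs]
  exact Finset.sum_eq_zero fun r _ ↦ h r

theorem mem_of_proj_mem {S : Submodule ℂ M} {m : M} (h : ∀ r, M.proj r m ∈ S) : m ∈ S := by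
  obtain ⟨s, hs⟩ := exists_eq_sum_proj m
  rw [hs]
  exact S.sum_mem fun r _ ↦ h r

theorem shortExact_iff (S : ShortComplex (GrLieMod.{u, w} 𝒶)) :
    S.ShortExact ↔ Function.Injective S.f.toLie ∧ Function.Surjective S.g.toLie ∧
      ∀ n, S.g.toLie n = 0 → ∃ m, S.f.toLie m = n := by
  constructor
  · intro hS
    have hmono := hS.mono_f
    have hepi := hS.epi_g
    refine ⟨injective_of_mono S.f, surjective_of_epi S.g, fun n hn ↦ ?_⟩
    obtain ⟨x, rfl⟩ := exists_kerι S.g n hn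
    let k := hS.fIsKernel.lift (KernelFork.ofι _ (kerι_comp S.g))
    have hk : k ≫ S.f = kerι S.g :=
      hS.fIsKernel.fac (KernelFork.ofι _ (kerι_comp S.g)) WalkingParallelPair.zero
    exact ⟨k.toLie x, by rw [← comp_toLie, hk]⟩
  · rintro ⟨hf, hg, hex⟩
    have hmono : Mono S.f := ⟨fun h k e ↦ by
      ext m
      exact hf (congrArg (fun φ ↦ Hom.toLie φ m) e)⟩
    have hepi : Epi S.g := ⟨fun h k e ↦ by
      ext m
      obtain ⟨n, rfl⟩ := hg m
      exact congrArg (fun φ ↦ Hom.toLie φ n) e⟩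
    exact { exact := S.exact_of_f_is_kernel (isLimitOfInjective S.f S.g S.zero hf hex) }

theorem isIso_of_bijective (f : M ⟶ N) (hf : Function.Bijective f.toLie) : IsIso f := by
  have hmono : Mono f := ⟨fun h k e ↦ by
    ext m
    exact hf.1 (congrArg (fun φ ↦ Hom.toLie φ m) e)⟩
  have hepi : Epi f := ⟨fun h k e ↦ by
    ext m
    obtain ⟨n, rfl⟩ := hf.2 m
    exact congrArg (fun φ ↦ Hom.toLie φ n) e⟩
  exact isIso_of_mono_of_epi f

/-- An additive functor is exact once it preserves short exact sequences, and these can be tested on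
vectors. -/
theorem preservesFiniteLimits_and_colimits (F : GrLieMod.{u, w} 𝒶 ⥤ GrLieMod.{u, w} 𝒶)
    [F.Additive] (h : ∀ S : ShortComplex (GrLieMod.{u, w} 𝒶), S.ShortExact →
      Function.Injective (F.map S.f).toLie ∧ Function.Surjective (F.map S.g).toLie ∧
        ∀ n, (F.map S.g).toLie n = 0 → ∃ m, (F.map S.f).toLie m = n) :
    PreservesFiniteLimits F ∧ PreservesFiniteColimits F :=
  (F.exact_tfae.out 0 3).mp fun S hS ↦ (shortExact_iff _).mpr (h S hS)

end GrLieMod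

/-! ### Isotypic parts of graded modules and stability under `g ⋉ V` -/

namespace GHat

variable {g : Type u} [LieRing g] [LieAlgebra ℂ g]
  {V : Type v} [AddCommGroup V] [Module ℂ V] [LieRingModule g V] [LieModule ℂ g V]

/-- The projection to a graded component. -/
noncomputable def component (M : GHat.{u, v, w} g V) (r : ℤ) : M →ₗ[ℂ] M.piece r :=
  (M.proj r).codRestrict (M.grade r) (M.proj_mem r)

/-- The inclusion of a graded component. -/
def pieceSubtype (M : GHat.{u, v, w} g V) (r : ℤ) : M.piece r →ₗ[ℂ] M := (M.grade r).subtype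

theorem pieceSubtype_component (M : GHat.{u, v, w} g V) (r : ℤ) (m : M) :
    M.pieceSubtype r (M.component r m) = M.proj r m := rfl

theorem pieceSubtype_injective (M : GHat.{u, v, w} g V) (r : ℤ) :
    Function.Injective (M.pieceSubtype r) := Subtype.val_injective

theorem component_pieceSubtype (M : GHat.{u, v, w} g V) (r : ℤ) (x : M.piece r) :
    M.component r (M.pieceSubtype r x) = x :=
  M.pieceSubtype_injective r ((M.proj_of_mem r r _ x.2).trans (if_pos rfl))

theorem component_pieceSubtype_of_ne (M : GHat.{u, v, w} g V) {r s : ℤ} (h : r ≠ s)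
    (x : M.piece s) : M.component r (M.pieceSubtype s x) = 0 :=
  M.pieceSubtype_injective r ((M.proj_of_mem r s _ x.2).trans (if_neg h))

theorem component_map {M N : GHat.{u, v, w} g V} (f : M ⟶ N) (r : ℤ) (m : M) :
    N.component r (f.toLie m) = mapPiece f r (M.component r m) :=
  N.pieceSubtype_injective r (GrLieMod.map_proj f r m).symm

theorem component_inl_lie (M : GHat.{u, v, w} g V) (r : ℤ) (x : g) (m : M) :
    M.component r ⁅SemidirectLie.inl g V x, m⁆ = ⁅x, M.component r m⁆ := by
  apply M.pieceSubtype_injective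
  have h := GrLieMod.proj_lie (M := M) (n := 0)
    (⟨x, rfl⟩ : SemidirectLie.inl g V x ∈ SemidirectLie.grading g V 0) r m
  simp only [Nat.cast_zero, add_zero] at h
  exact h

theorem inl_lie_inr (x : g) (v : V) :
    ⁅SemidirectLie.inl g V x, SemidirectLie.inr g V v⁆ = SemidirectLie.inr g V ⁅x, v⁆ := by
  refine Prod.ext ?_ ?_
  · change ⁅x, (0 : g)⁆ = 0
    simp
  · change ⁅x, v⁆ - ⁅(0 : g), (0 : V)⁆ = ⁅x, v⁆
    simp

/-- The action `V × M[r] → M[r + 1]`. -/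
noncomputable def act (M : GHat.{u, v, w} g V) (r : ℤ) :
    V →ₗ[ℂ] M.piece r →ₗ[ℂ] M.piece (r + 1) :=
  LinearMap.mk₂ ℂ (fun v m ↦ M.component (r + 1) ⁅SemidirectLie.inr g V v, M.pieceSubtype r m⁆)
    (fun v v' m ↦ by rw [map_add, add_lie, map_add])
    (fun c v m ↦ by rw [map_smul, smul_lie, map_smul])
    (fun v m m' ↦ by rw [map_add, lie_add, map_add])
    (fun c v m ↦ by rw [map_smul, lie_smul, map_smul])

theorem lie_act (M : GHat.{u, v, w} g V) (r : ℤ) (x : g) (v : V) (m : M.piece r) :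
    ⁅x, M.act r v m⁆ = M.act r ⁅x, v⁆ m + M.act r v ⁅x, m⁆ := by
  change ⁅x, M.component (r + 1) ⁅SemidirectLie.inr g V v, M.pieceSubtype r m⁆⁆ =
    M.component (r + 1) ⁅SemidirectLie.inr g V ⁅x, v⁆, M.pieceSubtype r m⁆ +
      M.component (r + 1) ⁅SemidirectLie.inr g V v, M.pieceSubtype r ⁅x, m⁆⁆
  rw [← component_inl_lie, leibniz_lie, inl_lie_inr, map_add]
  rfl

theorem component_inr_lie (M : GHat.{u, v, w} g V) (r : ℤ) (v : V) (m : M) :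
    M.component (r + 1) ⁅SemidirectLie.inr g V v, m⁆ = M.act r v (M.component r m) := by
  have hv : SemidirectLie.inr g V v ∈ SemidirectLie.grading g V 1 := ⟨v, rfl⟩
  apply M.pieceSubtype_injective
  have h := GrLieMod.proj_lie (M := M) hv r m
  have h' := GrLieMod.proj_lie (M := M) hv r (M.proj r m)
  rw [GrLieMod.proj_of_mem r r _ (M.proj_mem r m), if_pos rfl] at h'
  exact h.trans h'.symm

variable [FiniteDimensional ℂ g] [LieAlgebra.IsSemisimple ℂ g] [FiniteDimensional ℂ V]
  {H : LieSubalgebra ℂ g} [H.IsCartanSubalgebra]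
  {b : (LieAlgebra.IsKilling.rootSystem H).Base}

/-- The weights `lam` with `(lam, r) ∈ S`. -/
def fiber (S : Set (SimpleIndex b)) (r : ℤ) : Set (Module.Dual ℂ H) :=
  {lam | ∃ h : lam ∈ dominantWeights b, ((⟨lam, h⟩, r) : SimpleIndex b) ∈ S}

/-- The part of a graded module `M` which is the sum of the simple `g`-submodules of type `(lam, r)`
in `S`. -/
noncomputable def part (S : Set (SimpleIndex b)) (M : GHat.{u, v, w} g V) : Submodule ℂ M :=
  ⨅ r, (weightPart b (M.piece r) (fiber S r)).toSubmodule.comap (M.component r)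

theorem mem_part {S : Set (SimpleIndex b)} {M : GHat.{u, v, w} g V} {m : M} :
    m ∈ part S M ↔ ∀ r, M.component r m ∈ weightPart b (M.piece r) (fiber S r) := by
  simp [part]

theorem pieceSubtype_mem_part {S : Set (SimpleIndex b)} {M : GHat.{u, v, w} g V} {r : ℤ}
    {x : M.piece r} (hx : x ∈ weightPart b (M.piece r) (fiber S r)) :
    M.pieceSubtype r x ∈ part S M := by
  rw [mem_part]
  intro s
  by_cases h : s = r
  · subst h
    rwa [component_pieceSubtype]
  · rw [component_pieceSubtype_of_ne _ h]
    exact zero_mem _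

theorem proj_mem_part (S : Set (SimpleIndex b)) (M : GHat.{u, v, w} g V) (r : ℤ) (m : M)
    (hm : m ∈ part S M) : M.proj r m ∈ part S M :=
  pieceSubtype_mem_part (mem_part.mp hm r)

theorem map_mem_part {S : Set (SimpleIndex b)} {M N : GHat.{u, v, w} g V} (f : M ⟶ N) {m : M}
    (hm : m ∈ part S M) : f.toLie m ∈ part S N := by
  rw [mem_part] at hm ⊢
  intro r
  rw [component_map]
  exact map_mem_weightPart _ (hm r)

theorem disjoint_fiber {S T : Set (SimpleIndex b)} (h : Disjoint S T) (r : ℤ) :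
    Disjoint (fiber S r) (fiber T r) :=
  Set.disjoint_left.mpr fun _ ⟨_, h1⟩ ⟨_, h2⟩ ↦ Set.disjoint_left.mp h h1 h2

theorem eq_zero_of_mem_part {S T : Set (SimpleIndex b)} (h : Disjoint S T)
    {M : GHat.{u, v, w} g V} {m : M} (hS : m ∈ part S M) (hT : m ∈ part T M) : m = 0 := by
  rw [mem_part] at hS hT
  refine GrLieMod.eq_zero_of_proj fun r ↦ ?_
  rw [← pieceSubtype_component, eq_zero_of_mem_weightPart (disjoint_fiber h r) (hS r) (hT r),
    map_zero]

theorem exists_add_of_part (S : Set (SimpleIndex b)) {M : GHat.{u, v, w} g V} (m : M) :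
    ∃ x ∈ part S M, ∃ y ∈ part Sᶜ M, x + y = m := by
  rw [← Submodule.mem_sup]
  refine GrLieMod.mem_of_proj_mem fun r ↦ ?_
  obtain ⟨x, hx, y, hy, hxy⟩ := exists_add_of_weightPart (b := b) (S := fiber S r)
    (T := fiber Sᶜ r) (fun lam h ↦ (em (((⟨lam, h⟩, r) : SimpleIndex b) ∈ S)).imp
      (fun h' ↦ ⟨h, h'⟩) fun h' ↦ ⟨h, h'⟩) (M.component r m)
  rw [← pieceSubtype_component, ← hxy, map_add]
  exact add_mem (Submodule.mem_sup_left (pieceSubtype_mem_part hx))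
    (Submodule.mem_sup_right (pieceSubtype_mem_part hy))

variable (V) in
/-- Subsets of `Λ` which contain with `p` every `q` that covers `p`. -/
def IsUpClosed (S : Set (SimpleIndex b)) : Prop :=
  ∀ p q, Covers V p q → p ∈ S → q ∈ S

/-- This is where the covering relation enters: a weight of `V` joining a type in degree `r` to one
in degree `r + 1` is precisely a cover, since `V` is the piece of degree one. -/
theorem act_mem_weightPart {S : Set (SimpleIndex b)} (hS : IsUpClosed V S)
    (M : GHat.{u, v, w} g V) (r : ℤ) (v : V) {m : M.piece r}
    (hm : m ∈ weightPart b (M.piece r) (fiber S r)) :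
    M.act r v m ∈ weightPart b (M.piece (r + 1)) (fiber S (r + 1)) := by
  refine bilinear_mem_weightPart_of_mem (M.act r) (M.lie_act r) ?_ v hm
  rintro lam ⟨hlam, hlamS⟩ mu hmu v hv0 hv
  refine ⟨hmu, hS _ _ ⟨?_, ?_⟩ hlamS⟩
  · change r < r + 1
    omega
  · have h1 : (r + 1 - r).toNat = 1 := by simp
    change mu - lam ∈ gradedWeights V H (r + 1 - r).toNat
    rw [h1]
    refine ⟨SemidirectLie.inr g V v, ⟨v, rfl⟩, fun h ↦ hv0 (congrArg Prod.snd h), fun h ↦ ?_⟩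
    rw [inl_lie_inr, hv, map_smul]

/-- For an up-closed set `S`, the part of type `S` of `M` is a submodule. -/
noncomputable def lieSubmodulePart {S : Set (SimpleIndex b)} (hS : IsUpClosed V S)
    (M : GHat.{u, v, w} g V) : LieSubmodule ℂ (SemidirectLie g V) M :=
  { part S M with
    lie_mem := by
      intro x m hm
      change m ∈ part S M at hm
      change ⁅x, m⁆ ∈ part S M
      have hx : x = SemidirectLie.inl g V x.1 + SemidirectLie.inr g V x.2 :=
        Prod.ext (add_zero x.1).symm (zero_add x.2).symm
      rw [hx, add_lie]
      rw [mem_part] at hm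
      refine add_mem (mem_part.mpr fun r ↦ ?_) (mem_part.mpr fun r ↦ ?_)
      · rw [component_inl_lie]
        exact LieSubmodule.lie_mem _ (hm r)
      -- The component in degree `r` of `⁅V, m⁆` depends only on the component of `m` in degree `r -
      -- 1`.
      · obtain ⟨s, rfl⟩ : ∃ s, r = s + 1 := ⟨r - 1, by omega⟩
        rw [component_inr_lie]
        exact act_mem_weightPart hS M s _ (hm s) }

/-! ### The exact functors `M ↦ M_S` and `M ↦ M / M_S` -/

section Functors

variable {S : Set (SimpleIndex b)} (hS : IsUpClosed V S)

/-- The part of type `S` of `M`, as an object of `Ĝ`. -/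
noncomputable def upperPart (M : GHat.{u, v, w} g V) : GHat.{u, v, w} g V :=
  GrLieMod.sub M (lieSubmodulePart hS M) (proj_mem_part S M)

/-- The inclusion of the part of type `S`. -/
noncomputable def upperPartι (M : GHat.{u, v, w} g V) : upperPart hS M ⟶ M :=
  GrLieMod.subι M (lieSubmodulePart hS M) (proj_mem_part S M)

theorem upperPartι_injective (M : GHat.{u, v, w} g V) :
    Function.Injective (upperPartι hS M).toLie := Subtype.val_injective

theorem upperPartι_mem (M : GHat.{u, v, w} g V) (m : upperPart hS M) :
    (upperPartι hS M).toLie m ∈ part S M := m.2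

theorem exists_upperPartι {M : GHat.{u, v, w} g V} {m : M} (hm : m ∈ part S M) :
    ∃ x, (upperPartι hS M).toLie x = m := ⟨⟨m, hm⟩, rfl⟩

/-- The quotient of `M` by the part of type `S`. -/
noncomputable def lowerPart (M : GHat.{u, v, w} g V) : GHat.{u, v, w} g V :=
  GrLieMod.quot M (lieSubmodulePart hS M) (proj_mem_part S M)

/-- The projection to the quotient by the part of type `S`. -/
noncomputable def lowerPartπ (M : GHat.{u, v, w} g V) : M ⟶ lowerPart hS M :=
  GrLieMod.quotπ M (lieSubmodulePart hS M) (proj_mem_part S M)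

theorem lowerPartπ_surjective (M : GHat.{u, v, w} g V) :
    Function.Surjective (lowerPartπ hS M).toLie := LieSubmodule.Quotient.surjective_mk' _

theorem lowerPartπ_eq_zero_iff {M : GHat.{u, v, w} g V} {m : M} :
    (lowerPartπ hS M).toLie m = 0 ↔ m ∈ part S M :=
  LieSubmodule.Quotient.mk_eq_zero' (N := lieSubmodulePart hS M)

/-- The restriction of a morphism to the parts of type `S`. -/
noncomputable def upperPartMap {M N : GHat.{u, v, w} g V} (f : M ⟶ N) :
    upperPart hS M ⟶ upperPart hS N :=
  GrLieMod.liftInj (upperPartι hS N) (upperPartι_injective hS N) (upperPartι hS M ≫ f)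
    fun m ↦ exists_upperPartι hS (map_mem_part f (upperPartι_mem hS M m))

theorem upperPartMap_ι {M N : GHat.{u, v, w} g V} (f : M ⟶ N) (m : upperPart hS M) :
    (upperPartι hS N).toLie ((upperPartMap hS f).toLie m) =
      f.toLie ((upperPartι hS M).toLie m) :=
  congrArg (fun φ ↦ GrLieMod.Hom.toLie φ m) (GrLieMod.liftInj_spec (upperPartι hS N)
    (upperPartι_injective hS N) (upperPartι hS M ≫ f) _)

/-- The morphism induced on the quotients by the parts of type `S`. -/
noncomputable def lowerPartMap {M N : GHat.{u, v, w} g V} (f : M ⟶ N) :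
    lowerPart hS M ⟶ lowerPart hS N :=
  GrLieMod.descSurj (lowerPartπ hS M) (lowerPartπ_surjective hS M) (f ≫ lowerPartπ hS N)
    fun m hm ↦ (lowerPartπ_eq_zero_iff hS).mpr
      (map_mem_part f ((lowerPartπ_eq_zero_iff hS).mp hm))

theorem lowerPartMap_π {M N : GHat.{u, v, w} g V} (f : M ⟶ N) (m : M) :
    (lowerPartMap hS f).toLie ((lowerPartπ hS M).toLie m) =
      (lowerPartπ hS N).toLie (f.toLie m) :=
  congrArg (fun φ ↦ GrLieMod.Hom.toLie φ m) (GrLieMod.descSurj_spec (lowerPartπ hS M)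
    (lowerPartπ_surjective hS M) (f ≫ lowerPartπ hS N) fun m hm ↦ (lowerPartπ_eq_zero_iff hS).mpr
      (map_mem_part f ((lowerPartπ_eq_zero_iff hS).mp hm)))

/-- The functor which sends `M` to its part of type `S`. -/
noncomputable def upperPartFunctor : GHat.{u, v, w} g V ⥤ GHat.{u, v, w} g V where
  obj := upperPart hS
  map := upperPartMap hS
  map_id M := by
    ext m
    apply upperPartι_injective hS
    rw [upperPartMap_ι]
    rfl
  map_comp f f' := by
    ext m
    apply upperPartι_injective hS
    rw [upperPartMap_ι, GrLieMod.comp_toLie, GrLieMod.comp_toLie, upperPartMap_ι, upperPartMap_ι]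

/-- The functor which sends `M` to its quotient by the part of type `S`. -/
noncomputable def lowerPartFunctor : GHat.{u, v, w} g V ⥤ GHat.{u, v, w} g V where
  obj := lowerPart hS
  map := lowerPartMap hS
  map_id M := by
    ext m
    obtain ⟨m, rfl⟩ := lowerPartπ_surjective hS M m
    rw [lowerPartMap_π]
    rfl
  map_comp f f' := by
    ext m
    obtain ⟨m, rfl⟩ := lowerPartπ_surjective hS _ m
    rw [lowerPartMap_π, GrLieMod.comp_toLie, GrLieMod.comp_toLie, lowerPartMap_π, lowerPartMap_π]

instance : (upperPartFunctor.{u, v, w} hS).Additive where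
  map_add {M N f f'} := by
    change upperPartMap hS (f + f') = upperPartMap hS f + upperPartMap hS f'
    ext m
    apply upperPartι_injective hS
    rw [GrLieMod.add_toLie, map_add, upperPartMap_ι, upperPartMap_ι, upperPartMap_ι]
    rfl

instance : (lowerPartFunctor.{u, v, w} hS).Additive where
  map_add {M N f f'} := by
    change lowerPartMap hS (f + f') = lowerPartMap hS f + lowerPartMap hS f'
    ext m
    obtain ⟨m, rfl⟩ := lowerPartπ_surjective hS M m
    rw [GrLieMod.add_toLie, lowerPartMap_π, lowerPartMap_π, lowerPartMap_π, ← map_add]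
    rfl

/-- The inclusion of the part of type `S`, as a natural transformation. -/
noncomputable def upperPartFunctorι : upperPartFunctor.{u, v, w} hS ⟶ 𝟭 (GHat.{u, v, w} g V) where
  app := upperPartι hS
  naturality M N f := by
    ext m
    exact upperPartMap_ι hS f m

/-- The projection to the quotient by the part of type `S`, as a natural transformation. -/
noncomputable def lowerPartFunctorπ : 𝟭 (GHat.{u, v, w} g V) ⟶ lowerPartFunctor.{u, v, w} hS where
  app := lowerPartπ hS
  naturality M N f := by
    ext m
    exact (lowerPartMap_π hS f m).symm

/-- Split a preimage into its parts of type `S` and `Sᶜ`. The image of the second part has both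
types, so it vanishes. The complementary part is only a subspace here; it need not be stable under
`V`. -/
theorem exists_mem_part_of_surjective {M N : GHat.{u, v, w} g V} (f : M ⟶ N)
    (hf : Function.Surjective f.toLie) {n : N} (hn : n ∈ part S N) :
    ∃ m ∈ part S M, f.toLie m = n := by
  obtain ⟨m, rfl⟩ := hf n
  obtain ⟨x, hx, y, hy, rfl⟩ := exists_add_of_part S m
  refine ⟨x, hx, ?_⟩
  have h1 : f.toLie y ∈ part S N := by
    have : f.toLie y = f.toLie (x + y) - f.toLie x := by rw [map_add]; abel
    rw [this]
    exact sub_mem hn (map_mem_part f hx)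
  rw [map_add, eq_zero_of_mem_part disjoint_compl_right h1 (map_mem_part f hy), add_zero]

/-- The same splitting shows that the component of type `Sᶜ` maps to zero. So a submodule meets the
part of type `S` in its own part of that type, which gives exactness on the left. -/
theorem mem_part_of_injective {M N : GHat.{u, v, w} g V} (f : M ⟶ N)
    (hf : Function.Injective f.toLie) {m : M} (hm : f.toLie m ∈ part S N) : m ∈ part S M := by
  obtain ⟨x, hx, y, hy, rfl⟩ := exists_add_of_part S m
  have h1 : f.toLie y ∈ part S N := by
    have : f.toLie y = f.toLie (x + y) - f.toLie x := by rw [map_add]; abel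
    rw [this]
    exact sub_mem hm (map_mem_part f hx)
  have h2 : y = 0 := hf (by
    rw [eq_zero_of_mem_part disjoint_compl_right h1 (map_mem_part f hy), map_zero])
  rw [h2, add_zero]
  exact hx

theorem upperPartFunctor_exact : PreservesFiniteLimits (upperPartFunctor.{u, v, w} hS) ∧
    PreservesFiniteColimits (upperPartFunctor.{u, v, w} hS) := by
  refine GrLieMod.preservesFiniteLimits_and_colimits _ fun X hX ↦ ?_
  obtain ⟨hf, hg, hex⟩ := (GrLieMod.shortExact_iff X).mp hX
  refine ⟨fun x y hxy ↦ ?_, fun n ↦ ?_, fun n hn ↦ ?_⟩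
  · apply upperPartι_injective hS
    apply hf
    exact (upperPartMap_ι hS X.f x).symm.trans ((congrArg _ hxy).trans (upperPartMap_ι hS X.f y))
  · obtain ⟨m, hm, e⟩ := exists_mem_part_of_surjective X.g hg (upperPartι_mem hS _ n)
    obtain ⟨m, rfl⟩ := exists_upperPartι hS hm
    exact ⟨m, upperPartι_injective hS _ ((upperPartMap_ι hS X.g m).trans e)⟩
  · have h1 : X.g.toLie ((upperPartι hS _).toLie n) = 0 :=
      (upperPartMap_ι hS X.g n).symm.trans ((congrArg _ hn).trans (map_zero _))
    obtain ⟨m, hm⟩ := hex _ h1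
    obtain ⟨m, rfl⟩ := exists_upperPartι hS
      (mem_part_of_injective X.f hf (S := S) (m := m) (by rw [hm]; exact upperPartι_mem hS _ n))
    exact ⟨m, upperPartι_injective hS _ ((upperPartMap_ι hS X.f m).trans hm)⟩

theorem lowerPartFunctor_exact : PreservesFiniteLimits (lowerPartFunctor.{u, v, w} hS) ∧
    PreservesFiniteColimits (lowerPartFunctor.{u, v, w} hS) := by
  refine GrLieMod.preservesFiniteLimits_and_colimits _ fun X hX ↦ ?_
  obtain ⟨hf, hg, hex⟩ := (GrLieMod.shortExact_iff X).mp hX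
  refine ⟨(injective_iff_map_eq_zero _).mpr fun x hx ↦ ?_, fun n ↦ ?_, fun n hn ↦ ?_⟩
  · obtain ⟨m, rfl⟩ := lowerPartπ_surjective hS _ x
    have h1 := (lowerPartMap_π hS X.f m).symm.trans hx
    exact (lowerPartπ_eq_zero_iff hS).mpr
      (mem_part_of_injective X.f hf ((lowerPartπ_eq_zero_iff hS).mp h1))
  · obtain ⟨n, rfl⟩ := lowerPartπ_surjective hS _ n
    obtain ⟨m, rfl⟩ := hg n
    exact ⟨(lowerPartπ hS _).toLie m, lowerPartMap_π hS X.g m⟩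
  · obtain ⟨n, rfl⟩ := lowerPartπ_surjective hS _ n
    have h1 := (lowerPartπ_eq_zero_iff hS).mp ((lowerPartMap_π hS X.g n).symm.trans hn)
    -- Correcting `n` by a vector of type `S` with the same image puts it in the kernel of `X.g`,
    -- without changing its class in the quotient.
    obtain ⟨x, hx, e⟩ := exists_mem_part_of_surjective X.g hg h1
    obtain ⟨m, hm⟩ := hex (n - x) (by rw [map_sub, e, sub_self])
    refine ⟨(lowerPartπ hS _).toLie m, (lowerPartMap_π hS X.f m).trans ?_⟩
    rw [hm, map_sub, (lowerPartπ_eq_zero_iff hS).mpr hx, sub_zero]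

end Functors

end GHat

/-! ### Truncation to an interval-closed set -/

namespace GHat

variable {g : Type u} [LieRing g] [LieAlgebra ℂ g]
  {V : Type v} [AddCommGroup V] [Module ℂ V] [LieRingModule g V] [LieModule ℂ g V]
  [FiniteDimensional ℂ V] [FiniteDimensional ℂ g] [LieAlgebra.IsSemisimple ℂ g]
  {H : LieSubalgebra ℂ g} [H.IsCartanSubalgebra]
  {b : (LieAlgebra.IsKilling.rootSystem H).Base} {M : GHat.{u, v, w} g V}

theorem multPos_of_isSimpleOfHighestWeight {r : ℤ} {N : LieSubmodule ℂ g (M.piece r)}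
    {lam : Module.Dual ℂ H} (hN : IsSimpleOfHighestWeight b lam N) :
    MultPos (b := b) M (⟨lam, hN.mem_dominantWeights⟩, r) := by
  refine ⟨N, inferInstance, inferInstance, inferInstance, inferInstance, inferInstance, hN,
    N.incl, fun h ↦ ?_⟩
  obtain ⟨-, v, hv0, -⟩ := id hN
  exact hv0 (Subtype.ext (LieModuleHom.congr_fun h v))

/-- The simple submodules that generate the part of type `S` would be constituents of `M`, so their
types would lie in both `Γ` and `S`. -/
theorem part_eq_bot {Γ S : Set (SimpleIndex b)} (hM : ∀ p, MultPos M p → p ∈ Γ)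
    (hS : Disjoint Γ S) : part S M = ⊥ := by
  rw [eq_bot_iff]
  intro m hm
  rw [mem_part] at hm
  refine GrLieMod.eq_zero_of_proj fun r ↦ ?_
  have h : weightPart b (M.piece r) (fiber S r) = ⊥ := by
    refine sSup_eq_bot.mpr ?_
    rintro N ⟨lam, ⟨hlam, hlamS⟩, hN⟩
    exact absurd hlamS (Set.disjoint_left.mp hS (hM _ (multPos_of_isSimpleOfHighestWeight hN)))
  have := hm r
  rw [h, LieSubmodule.mem_bot] at this
  rw [← pieceSubtype_component, this, map_zero]

theorem part_eq_top {Γ S : Set (SimpleIndex b)} (hM : ∀ p, MultPos M p → p ∈ Γ)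
    (hS : Γ ⊆ S) : part S M = ⊤ := by
  rw [eq_top_iff]
  rintro m -
  obtain ⟨x, hx, y, hy, rfl⟩ := exists_add_of_part S m
  rw [part_eq_bot (S := Sᶜ) hM (Set.disjoint_left.mpr fun p hp hp' ↦ hp' (hS hp))] at hy
  rw [(Submodule.mem_bot _).mp hy, add_zero]
  exact hx

/-- A nonzero component `M[r]` contains a simple module, so `r` occurs as a degree in `Γ`.
Finiteness of `Γ` thus leaves finitely many components, each finite-dimensional. -/
theorem finiteDimensional_of_multPos {Γ : Set (SimpleIndex b)} (hfin : Γ.Finite)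
    (hM : ∀ p, MultPos M p → p ∈ Γ) : FiniteDimensional ℂ M := by
  classical
  let s := hfin.toFinset.image Prod.snd
  have htop : s.sup M.grade = ⊤ := by
    rw [eq_top_iff]
    rintro m -
    refine GrLieMod.mem_of_proj_mem fun r ↦ ?_
    by_cases hr : r ∈ s
    · exact Finset.le_sup (f := M.grade) hr (M.proj_mem r m)
    · have h : (⊤ : LieSubmodule ℂ g (M.piece r)) = ⊥ := by
        by_contra hne
        obtain ⟨N, -, lam, hN⟩ := exists_isSimpleOfHighestWeight_le b hne
        exact hr (Finset.mem_image.mpr ⟨(⟨lam, hN.mem_dominantWeights⟩, r),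
          hfin.mem_toFinset.mpr (hM _ (multPos_of_isSimpleOfHighestWeight hN)), rfl⟩)
      have hm : M.component r m ∈ (⊤ : LieSubmodule ℂ g (M.piece r)) := trivial
      rw [h, LieSubmodule.mem_bot] at hm
      rw [← pieceSubtype_component, hm, map_zero]
      exact zero_mem _
  have h1 : FiniteDimensional ℂ (s.sup M.grade : Submodule ℂ M) :=
    Submodule.finiteDimensional_finset_sup s M.grade
  rw [htop] at h1
  exact Module.Finite.of_surjective (⊤ : Submodule ℂ M).subtype fun m ↦ ⟨⟨m, trivial⟩, rfl⟩

theorem mem_of_multPos_upperPart {S : Set (SimpleIndex b)} (hS : IsUpClosed V S)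
    {p : SimpleIndex b} (hp : MultPos (upperPart hS M) p) : p ∈ S := by
  obtain ⟨L, _, _, _, _, _, hL, φ, hφ⟩ := hp
  let ψ := (mapPiece (upperPartι hS M) p.2).comp φ
  have hψ : ψ ≠ 0 := fun h ↦ hφ (by
    ext l
    exact mapPiece_injective _ (upperPartι_injective hS M) p.2
      ((LieModuleHom.congr_fun h l).trans (map_zero (mapPiece (upperPartι hS M) p.2)).symm))
  have hle : ψ.range ≤ weightPart b (M.piece p.2) (fiber S p.2) := by
    intro m hm
    obtain ⟨l, rfl⟩ := (LieModuleHom.mem_range _ _).mp hm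
    have h1 := mem_part.mp (upperPartι_mem hS M ((upperPart hS M).pieceSubtype p.2 (φ l))) p.2
    rw [component_map, component_pieceSubtype] at h1
    exact h1
  exact (mem_of_le_weightPart (hL.range hψ) hle).2

/-- By complete reducibility a simple constituent of the quotient lifts to `M`. If its type were in
`S`, the lift would land in the part that is divided out. -/
theorem multPos_of_multPos_lowerPart {S : Set (SimpleIndex b)} (hS : IsUpClosed V S)
    {p : SimpleIndex b} (hp : MultPos (lowerPart hS M) p) : MultPos M p ∧ p ∉ S := by
  obtain ⟨L, _, _, _, _, _, hL, φ, hφ⟩ := hp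
  obtain ⟨ψ, hψ⟩ := weyl_lift (mapPiece (lowerPartπ hS M) p.2)
    (mapPiece_surjective _ (lowerPartπ_surjective hS M) p.2) φ
  have hψ0 : ψ ≠ 0 := fun h ↦ hφ (by
    ext l
    rw [← hψ, h]
    simp)
  refine ⟨⟨L, _, _, _, _, inferInstance, hL, ψ, hψ0⟩, fun hpS ↦ hφ ?_⟩
  ext l
  have h1 : ψ l ∈ weightPart b (M.piece p.2) (fiber S p.2) :=
    le_weightPart (⟨p.1.2, hpS⟩ : (p.1 : Module.Dual ℂ H) ∈ fiber S p.2) (hL.range hψ0)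
      ((LieModuleHom.mem_range _ _).mpr ⟨l, rfl⟩)
  have h2 := (lowerPartπ_eq_zero_iff hS).mpr (pieceSubtype_mem_part h1)
  rw [← hψ]
  exact Subtype.ext h2

variable (V) in
/-- The smallest up-closed set which contains `Γ`. -/
def upClosure (Γ : Set (SimpleIndex b)) : Set (SimpleIndex b) :=
  {t | ∃ x ∈ Γ, Precedes V x t}

theorem subset_upClosure (Γ : Set (SimpleIndex b)) : Γ ⊆ upClosure V Γ :=
  fun x hx ↦ ⟨x, hx, Relation.ReflTransGen.refl⟩

theorem isUpClosed_upClosure (Γ : Set (SimpleIndex b)) : IsUpClosed V (upClosure V Γ) :=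
  fun _ _ hpq ⟨x, hx, h⟩ ↦ ⟨x, hx, h.tail hpq⟩

/-- If `q` in `Γ` covered a `p` from the difference, then `p` would lie between an element of `Γ`
and `q`, and so belong to `Γ`. -/
theorem isUpClosed_upClosure_diff {Γ : Set (SimpleIndex b)} (hΓ : IsIntervalClosed V Γ) :
    IsUpClosed V (upClosure V Γ \ Γ) := by
  rintro p q hpq ⟨hp, hpΓ⟩
  refine ⟨isUpClosed_upClosure Γ p q hpq hp, fun hq ↦ hpΓ ?_⟩
  obtain ⟨x, hx, h⟩ := hp
  exact hΓ x hx q hq p h (Relation.ReflTransGen.single hpq)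

section Truncation

variable {Γ : Set (SimpleIndex b)} (hΓ : IsIntervalClosed V Γ)

/-- The subquotient of type `Γ` of a graded module, for `Γ` interval-closed. -/
noncomputable def subquotientFunctor : GHat.{u, v, w} g V ⥤ GHat.{u, v, w} g V :=
  upperPartFunctor (isUpClosed_upClosure Γ) ⋙ lowerPartFunctor (isUpClosed_upClosure_diff hΓ)

theorem truncated_subquotientFunctor (hfin : Γ.Finite) (M : GHat.{u, v, w} g V) :
    truncated V Γ ((subquotientFunctor hΓ).obj M) := by
  have h : ∀ p, MultPos ((subquotientFunctor hΓ).obj M) p → p ∈ Γ := by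
    intro p hp
    obtain ⟨h1, h2⟩ := multPos_of_multPos_lowerPart (isUpClosed_upClosure_diff hΓ) hp
    by_contra hpΓ
    exact h2 ⟨mem_of_multPos_upperPart (isUpClosed_upClosure Γ) h1, hpΓ⟩
  exact ⟨finiteDimensional_of_multPos hfin h, h⟩

variable (hfin : Γ.Finite)

/-- The subquotient of type `Γ`, as a functor with values in `G[Γ]`. -/
noncomputable def truncation : GHat.{u, v, w} g V ⥤ (truncated.{u, v, w} V Γ).FullSubcategory :=
  (truncated V Γ).lift (subquotientFunctor hΓ) (truncated_subquotientFunctor hΓ hfin)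

theorem truncation_exact : (truncation.{u, v, w} hΓ hfin).Additive ∧
    PreservesFiniteLimits (truncation.{u, v, w} hΓ hfin) ∧
    PreservesFiniteColimits (truncation.{u, v, w} hΓ hfin) := by
  obtain ⟨hl, hc⟩ := upperPartFunctor_exact.{u, v, w} (isUpClosed_upClosure (V := V) Γ)
  obtain ⟨hl', hc'⟩ := lowerPartFunctor_exact.{u, v, w} (isUpClosed_upClosure_diff hΓ)
  have hL : PreservesFiniteLimits (truncation.{u, v, w} hΓ hfin ⋙ (truncated V Γ).ι) :=
    inferInstanceAs (PreservesFiniteLimits (upperPartFunctor.{u, v, w} (isUpClosed_upClosure Γ) ⋙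
      lowerPartFunctor (isUpClosed_upClosure_diff hΓ)))
  have hC : PreservesFiniteColimits (truncation.{u, v, w} hΓ hfin ⋙ (truncated V Γ).ι) :=
    inferInstanceAs (PreservesFiniteColimits (upperPartFunctor.{u, v, w} (isUpClosed_upClosure Γ) ⋙
      lowerPartFunctor (isUpClosed_upClosure_diff hΓ)))
  have hA : (truncation.{u, v, w} hΓ hfin ⋙ (truncated V Γ).ι).Additive :=
    inferInstanceAs (Functor.Additive (upperPartFunctor.{u, v, w} (isUpClosed_upClosure Γ) ⋙
      lowerPartFunctor (isUpClosed_upClosure_diff hΓ)))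
  -- The inclusion of the full subcategory is faithful and reflects limits and colimits, so
  -- additivity and exactness may be tested after composing with it.
  refine ⟨⟨fun {M N f f'} ↦ (truncated V Γ).ι.map_injective ?_⟩, ⟨fun J _ _ ↦ ?_⟩,
    ⟨fun J _ _ ↦ ?_⟩⟩
  · exact (truncation.{u, v, w} hΓ hfin ⋙ (truncated V Γ).ι).map_add
  · exact preservesLimitsOfShape_of_reflects_of_preserves _ (truncated V Γ).ι
  · exact preservesColimitsOfShape_of_reflects_of_preserves _ (truncated V Γ).ι

/-- The projection of the part of type `upClosure V Γ` onto the subquotient of type `Γ`. -/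
noncomputable def truncationπ : upperPartFunctor.{u, v, w} (isUpClosed_upClosure (V := V) Γ) ⟶
    truncation hΓ hfin ⋙ (truncated V Γ).ι :=
  Functor.whiskerLeft (upperPartFunctor.{u, v, w} (isUpClosed_upClosure (V := V) Γ))
    (lowerPartFunctorπ (isUpClosed_upClosure_diff hΓ))

/-- All types of `M` lie in `Γ`, hence in its up-closure, so nothing is lost. -/
theorem isIso_upperPartι {M : GHat.{u, v, w} g V} (hM : ∀ p, MultPos M p → p ∈ Γ) :
    IsIso (upperPartι (isUpClosed_upClosure Γ) M) := by
  refine GrLieMod.isIso_of_bijective _ ⟨upperPartι_injective _ M, fun m ↦ ?_⟩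
  exact exists_upperPartι _ (by rw [part_eq_top hM (subset_upClosure Γ)]; trivial)

/-- No type of `M` lies in the difference of the up-closure and `Γ`, so nothing is divided out. -/
theorem isIso_lowerPartπ {M : GHat.{u, v, w} g V} (hM : ∀ p, MultPos M p → p ∈ Γ) :
    IsIso (lowerPartπ (isUpClosed_upClosure_diff hΓ) M) := by
  refine GrLieMod.isIso_of_bijective _ ⟨(injective_iff_map_eq_zero _).mpr fun m hm ↦ ?_,
    lowerPartπ_surjective _ M⟩
  rw [lowerPartπ_eq_zero_iff, part_eq_bot hM Set.disjoint_sdiff_right] at hm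
  simpa using hm

theorem mapExactFunctor_truncated_bijective
    (hΓ : IsIntervalClosed V Γ) (hfin : Γ.Finite)
    (X Y : (truncated.{u, v, w} V Γ).FullSubcategory) (j : ℕ) :
    Function.Bijective fun ξ : Abelian.Ext.{max u v (w + 1)} X Y j ↦
      (ξ.mapExactFunctor (truncated V Γ).ι : Abelian.Ext.{max u v (w + 1)} _ _ j) := by
  obtain ⟨hl, hc⟩ := upperPartFunctor_exact.{u, v, w} (isUpClosed_upClosure (V := V) Γ)
  obtain ⟨hA, hL, hC⟩ := truncation_exact.{u, v, w} hΓ hfin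
  refine Abelian.Ext.mapExactFunctor_bijective_of_zigzag (truncated V Γ).ι
    (upperPartFunctor (isUpClosed_upClosure Γ)) (truncation hΓ hfin)
    (upperPartFunctorι (isUpClosed_upClosure Γ)) (truncationπ hΓ hfin) (fun X ↦ ?_) (fun X ↦ ?_)
    X Y j
  · exact isIso_upperPartι X.property.2
  -- The projection starts at the upper part of `X`, which is isomorphic to `X` and so again has all
  -- its types in `Γ`.
  · refine isIso_lowerPartπ hΓ (M := upperPart (isUpClosed_upClosure Γ) X.obj) ?_
    have := isIso_upperPartι X.property.2
    exact ((truncated V Γ).prop_of_iso (asIso (upperPartι (isUpClosed_upClosure Γ) X.obj)).symm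
      X.property).2

end Truncation

end GHat

theorem propositionP62
    {g : Type u} [LieRing g] [LieAlgebra ℂ g] [FiniteDimensional ℂ g] [LieAlgebra.IsSemisimple ℂ g]
    {H : LieSubalgebra ℂ g} [H.IsCartanSubalgebra] (b : (LieAlgebra.IsKilling.rootSystem H).Base)
    {V : Type v} [AddCommGroup V] [Module ℂ V] [LieRingModule g V] [LieModule ℂ g V]
    [FiniteDimensional ℂ V]
    (Γ : Set (SimpleIndex b)) (hfin : Γ.Finite) (hΓ : IsIntervalClosed V Γ)
    (p q : SimpleIndex b) (hp : p ∈ Γ) (hq : q ∈ Γ)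
    {L : Type w} [AddCommGroup L] [Module ℂ L] [LieRingModule g L] [LieModule ℂ g L]
    [FiniteDimensional ℂ L] (hL : IsSimpleOfHighestWeight b (p.1 : Module.Dual ℂ H) L)
    {L' : Type w} [AddCommGroup L'] [Module ℂ L'] [LieRingModule g L'] [LieModule ℂ g L']
    [FiniteDimensional ℂ L'] (hL' : IsSimpleOfHighestWeight b (q.1 : Module.Dual ℂ H) L')
    (j : ℕ) :
    ∃ e : Abelian.Ext.{max u v (w + 1)} (simpleObj V Γ hp L hL) (simpleObj V Γ hq L' hL') j ≃ₗ[ℂ]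
        Abelian.Ext.{max u v (w + 1)} (GHat.shiftedEv V L p.2) (GHat.shiftedEv V L' q.2) j,
      ∀ x, e x = x.mapExactFunctor (truncated V Γ).ι := by
  have hbij := GHat.mapExactFunctor_truncated_bijective hΓ hfin (simpleObj V Γ hp L hL)
    (simpleObj V Γ hq L' hL') j
  -- Exact linear functors act linearly on Ext, so the bijection is already the required
  -- isomorphism.
  exact ⟨LinearEquiv.ofBijective ((truncated V Γ).ι.mapExtLinearMap ℂ _ _ j) hbij, fun _ ↦ rfl⟩
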